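/- Let $\mathbb{R}^{2n}$ carry the standard symplectic form $\omega_0=\sum_j dp_j\wedge dq_j$, and for a function $G$ let $X_G$ be given by $i_{X_G}\omega_0=-dG$. A normalized Hamiltonian on $[a,b]$ is a smooth function $F:\mathbb{R}^{2n}\times[a,b]\to\mathbb{R}$ such that the supports of all $F_t=F(\cdot,t)$ lie in one compact set. A smooth family of diffeomorphisms $f_t$, $t\in[a,b]$, is generated by $F$ if $\frac{d}{dt}f_t(x)=X_{F_t}(f_t(x))$ for all $x$ and $t$. The Hamiltonian isotopy of a normalized $H$ on $[0,1]$ is the family $\{\varphi_H^t\}_{t\in[0,1]}$ generated by $H$ with $\varphi_H^0=\mathrm{id}$; put $\varphi_H=\varphi_H^1$. Let $\mathrm{Ham}$ be the group of all maps $\varphi_H$ obtained in this way. Let $k\ge 0$ be an integer. Let $f:[0,1]\to\mathrm{Ham}$ be a continuous, piecewise smooth path: there are a division $0=t_0<t_1<\dots<t_m=1$ and normalized Hamiltonians $F^l$ on $[t_{l-1},t_l]$ generating $f|_{[t_{l-1},t_l]}$, $l=1,\dots,m$. Put $$\mathrm{Length}_k^*(f)=\sum_{i=0}^k\ \max_{1\le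 l\le m}\ \max_{t_{l-1}\le t\le t_l}\Big(\max_x\frac{\partial^iF^l}{\partial t^i}(x,t)-\min_x\frac{\partial^iF^l}{\partial t^i}(x,t)\Big),$$ where derivatives at the endpoints of $[t_{l-1},t_l]$ are one-sided. Let $d_k^*(\varphi,\psi)$ be the infimum of $\mathrm{Length}_k^*(f)$ over all such paths $f$ from $\varphi$ to $\psi$, and $\|\varphi\|_k^*=d_k^*(\varphi,\mathrm{id})$. Call two sets $A,B\subset\mathbb{R}^{2n}$ properly separated if there is $\tau\in\mathrm{Ham}$ such that $\tau(A)$ and $\tau(B)$ lie in the two different open half-spaces bounded by some affine hyperplane. For $S\subset\mathbb{R}^{2n}$ the coarse proper displacement $k$-energy $e_{p,k}^*(S)\in[0,\infty]$ is the infimum (with $\inf\emptyset=\infty$) of all real $a>0$ such that for every bounded $A\subset S$ there is $\psi\in\mathrm{Ham}$ with $\|\psi\|_k^*\le a$ for which $A$ and $\psi(A)$ are properly separated. **Theorem.** Let $U\subset\mathbb{R}^{2n}$, let $k\ge 0$ be an integer, and let $H$ be a normalized Hamiltonian on $[0,1]$ with $\mathrm{supp}(H)\subset U\times[0,1]$,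 where $\mathrm{supp}(H)$ is the closure of $\{H\neq 0\}$ in $\mathbb{R}^{2n}\times[0,1]$. Then $$\|\varphi_H\|_k^*\le 2^{2k+4}(k+1)\big(1+2^{k+1}+2^{2k+2}+2^{3k+3}\big)\,e_{p,k}^*(U).$$ -/

import Mathlib

noncomputable section

namespace CoarseHofer

open Set
open scoped ContDiff ENNReal

/-- The phase space `ℝ²ⁿ`. The coordinate indexed by `Sum.inl j` is `q_j` and the one indexed by
`Sum.inr j` is `p_j`. -/
abbrev Phase (n : ℕ) : Type := EuclideanSpace ℝ (Fin n ⊕ Fin n)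

/-- The standard symplectic form `ω₀ = ∑ dp_j ∧ dq_j` on `ℝ²ⁿ`. -/
def omega {n : ℕ} (u v : Phase n) : ℝ :=
  ∑ j : Fin n, (u (Sum.inr j) * v (Sum.inl j) - u (Sum.inl j) * v (Sum.inr j))

/-- The Hamiltonian vector field `X_G = (∂G/∂p, -∂G/∂q)` of a function `G` on `ℝ²ⁿ`. -/
def hamField {n : ℕ} (G : Phase n → ℝ) (x : Phase n) : Phase n :=
  WithLp.toLp 2 (Sum.elim
    (fun j => fderiv ℝ G x (EuclideanSpace.single (Sum.inr j) 1))
    (fun j => - fderiv ℝ G x (EuclideanSpace.single (Sum.inl j) 1)))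

/-- The defining relation `i_{X_G} ω₀ = -dG`. -/
theorem omega_hamField {n : ℕ} (G : Phase n → ℝ) (x v : Phase n) :
    omega (hamField G x) v = - fderiv ℝ G x v := by
  have hv : v = ∑ i : Fin n ⊕ Fin n, v i • EuclideanSpace.single i (1 : ℝ) := by
    simpa using ((EuclideanSpace.basisFun (Fin n ⊕ Fin n) ℝ).sum_repr v).symm
  conv_rhs => rw [hv, map_sum]
  simp only [omega, hamField, Sum.elim_inl, Sum.elim_inr, map_smul, smul_eq_mul,
    Fintype.sum_sum_type]
  rw [neg_add, ← Finset.sum_neg_distrib, ← Finset.sum_neg_distrib, ← Finset.sum_add_distrib]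
  exact Finset.sum_congr rfl fun j _ => by ring

/-- A normalized time-dependent Hamiltonian `F : ℝ²ⁿ × [a,b] → ℝ` (time is written first): it is
smooth on `[a,b] × ℝ²ⁿ` and the supports of all `F_t`, `t ∈ [a,b]`, lie in one compact set. Values
at times outside `[a,b]` are irrelevant. -/
structure IsNormalized {n : ℕ} (a b : ℝ) (F : ℝ → Phase n → ℝ) : Prop where
  smooth : ContDiffOn ℝ ∞ (fun z : ℝ × Phase n => F z.1 z.2) (Icc a b ×ˢ univ)
  compact : ∃ K : Set (Phase n), IsCompact K ∧ ∀ t ∈ Icc a b, ∀ x, x ∉ K → F t x = 0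

/-- The family `f_t`, `t ∈ [a,b]`, is a smooth family of diffeomorphisms of `ℝ²ⁿ` which is
generated by `F`: `d/dt f_t(x) = X_{F_t}(f_t(x))` (one-sided derivatives at `a` and `b`). -/
structure IsGeneratedBy {n : ℕ} (a b : ℝ) (F : ℝ → Phase n → ℝ)
    (f : ℝ → Equiv.Perm (Phase n)) : Prop where
  smooth : ContDiffOn ℝ ∞ (fun z : ℝ × Phase n => f z.1 z.2) (Icc a b ×ˢ univ)
  smooth_symm : ContDiffOn ℝ ∞ (fun z : ℝ × Phase n => (f z.1).symm z.2) (Icc a b ×ˢ univ)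
  ode : ∀ t ∈ Icc a b, ∀ x,
    HasDerivWithinAt (fun s => f s x) (hamField (F t) (f t x)) (Icc a b) t

/-- `{f_t}`, `t ∈ [0,1]`, is the Hamiltonian isotopy (the flow starting at the identity) generated
by `H`. -/
def IsHamIsotopy {n : ℕ} (H : ℝ → Phase n → ℝ) (f : ℝ → Equiv.Perm (Phase n)) : Prop :=
  IsGeneratedBy 0 1 H f ∧ f 0 = 1

/-- `Ham(ℝ²ⁿ, ω₀)`: the time-one maps of Hamiltonian isotopies generated by normalized
Hamiltonians. -/
def Ham (n : ℕ) : Set (Equiv.Perm (Phase n)) :=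
  {φ | ∃ (H : ℝ → Phase n → ℝ) (f : ℝ → Equiv.Perm (Phase n)),
    IsNormalized 0 1 H ∧ IsHamIsotopy H f ∧ f 1 = φ}

/-- A continuous and piecewise smooth path `f : [0,1] → Ham(ℝ²ⁿ, ω₀)` from `φ` to `ψ`, with a
division `0 = t_0 < ⋯ < t_m = 1` and normalized Hamiltonians `F^l` on `[t_l, t_{l+1}]` that
generate its smooth pieces. -/
structure HamPath {n : ℕ} (φ ψ : Equiv.Perm (Phase n)) where
  m : ℕ
  t : Fin (m + 1) → ℝ
  strictMono_t : StrictMono t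
  t_zero : t 0 = 0
  t_last : t (Fin.last m) = 1
  f : ℝ → Equiv.Perm (Phase n)
  f_mem : ∀ s ∈ Icc (0 : ℝ) 1, f s ∈ Ham n
  f_zero : f 0 = φ
  f_one : f 1 = ψ
  F : Fin m → ℝ → Phase n → ℝ
  normalized : ∀ l : Fin m, IsNormalized (t l.castSucc) (t l.succ) (F l)
  generated : ∀ l : Fin m, IsGeneratedBy (t l.castSucc) (t l.succ) (F l) f

/-- `‖G‖_∞ = max G - min G`, written as `sup_{x,y} (G x - G y)` in `[0,∞]`. -/
def osc {n : ℕ} (G : Phase n → ℝ) : ℝ≥0∞ :=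
  ⨆ (x : Phase n) (y : Phase n), ENNReal.ofReal (G x - G y)

/-- The coarse `k`-length
`∑_{i=0}^k max_l max_{t_l ≤ s ≤ t_{l+1}} ‖∂^i F^l / ∂t^i (·, s)‖_∞`. -/
def HamPath.length {n : ℕ} {φ ψ : Equiv.Perm (Phase n)} (γ : HamPath φ ψ) (k : ℕ) : ℝ≥0∞ :=
  ∑ i ∈ Finset.range (k + 1), ⨆ l : Fin γ.m, ⨆ s ∈ Icc (γ.t l.castSucc) (γ.t l.succ),
    osc (fun x =>
      iteratedDerivWithin i (fun r => γ.F l r x) (Icc (γ.t l.castSucc) (γ.t l.succ)) s)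

/-- `d_k^*(φ, ψ)`. -/
def coarseDist {n : ℕ} (k : ℕ) (φ ψ : Equiv.Perm (Phase n)) : ℝ≥0∞ :=
  ⨅ γ : HamPath φ ψ, γ.length k

/-- `‖φ‖_k^* = d_k^*(φ, id)`. -/
def coarseNorm {n : ℕ} (k : ℕ) (φ : Equiv.Perm (Phase n)) : ℝ≥0∞ :=
  coarseDist k φ 1

/-- Two sets are properly separated if some Hamiltonian diffeomorphism moves them to different
sides of an affine hyperplane. -/
def ProperlySeparated {n : ℕ} (A B : Set (Phase n)) : Prop :=
  ∃ τ ∈ Ham n, ∃ (ℓ : Phase n →L[ℝ] ℝ) (c : ℝ), ℓ ≠ 0 ∧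
    (∀ x ∈ A, ℓ (τ x) < c) ∧ ∀ y ∈ B, c < ℓ (τ y)

/-- The coarse proper displacement `k`-energy `e_{p,k}^*(S) ∈ [0,∞]` (with `inf ∅ = ∞`). -/
def properEnergy {n : ℕ} (k : ℕ) (S : Set (Phase n)) : ℝ≥0∞ :=
  sInf {a : ℝ≥0∞ | 0 < a ∧ a ≠ ⊤ ∧ ∀ A : Set (Phase n), A ⊆ S → Bornology.IsBounded A →
    ∃ ψ ∈ Ham n, coarseNorm k ψ ≤ a ∧ ProperlySeparated A (ψ '' A)}

end CoarseHofer

end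

noncomputable section

namespace CoarseHofer

open Set
open scoped ContDiff ENNReal

/-! The proof is an infinite-repetition trick carried out with finitely many copies. Let `K` be the
projection of the support of `H`, let `ψ` properly separate `K` from `ψ(K)`, and take a path from
`ψ` to the identity whose Hamiltonians vanish off a compact set `B`. Because of the separation there
are commuting symplectic maps `T` and `D`, conjugates of shears (`exists_disjointSlots`), such that
the sets `T ^ j (B ∪ K)` are pairwise disjoint, `D` is the identity on `K`, and `D = T` on `ψ(K)`.
They need not be compactly supported, since they only serve to conjugate.

Let `Ψ` be the product of `N + 1` copies of `ψ` placed in these slots. Disjointness of the slots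
makes `Ψ` no longer than `ψ` (`Reach.slotProd`), and `W = Ψ⁻¹ D Ψ D⁻¹` acts as `T` on the first `N`
copies of `K` (`displaced_apply`). With `φ^t` the isotopy of `H`, put `φ^{1 - j/N}` in slot `j` and
call the product `h`. Then `W h W⁻¹ = T h T⁻¹`, and moving `h` by one slot changes it only by `φ_H`
and by increments over time `1/N`. So `φ_H` is the commutator of `h` and `W` times an error of
length `O(1/N)` (`exists_reach_of_displaced`).

The commutator contains four conjugates of `Ψ` or `Ψ⁻¹`, whatever the size of `h`. Each
concatenation on `[0,1]` doubles the speed and costs `2 ^ (i + 1)` on the `i`-th time derivative.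
Three nested concatenations and four copies give `2 ^ (3 * i + 5)`, and `N → ∞` removes the error.
The resulting factor `2 ^ (3 * k + 5)` is below the stated constant. -/

theorem two_le_infty : (2 : WithTop ℕ∞) ≤ (∞ : WithTop ℕ∞) :=
  WithTop.coe_le_coe.2 (le_top : (2 : ℕ∞) ≤ ⊤)

/-! ### Calculus on slabs `[a,b] × E`, with one-sided time derivatives -/

section Slab

variable {E G : Type*} [NormedAddCommGroup E] [NormedSpace ℝ E]
  [NormedAddCommGroup G] [NormedSpace ℝ G] {Φ : ℝ × E → G} {a b t : ℝ} {x : E}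

theorem uniqueDiffOn_slab (hab : a < b) : UniqueDiffOn ℝ (Icc a b ×ˢ (univ : Set E)) :=
  (uniqueDiffOn_Icc hab).prod uniqueDiffOn_univ

theorem contDiff_slice (hΦ : ContDiffOn ℝ ∞ Φ (Icc a b ×ˢ univ)) (ht : t ∈ Icc a b) :
    ContDiff ℝ ∞ fun y => Φ (t, y) := by
  rw [← contDiffOn_univ]
  exact hΦ.comp (contDiff_prodMk_right t).contDiffOn fun y _ => ⟨ht, mem_univ _⟩

theorem contDiffOn_line (hΦ : ContDiffOn ℝ ∞ Φ (Icc a b ×ˢ univ)) (x : E) :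
    ContDiffOn ℝ ∞ (fun s => Φ (s, x)) (Icc a b) :=
  hΦ.comp (contDiff_prodMk_left x).contDiffOn fun _ hs => ⟨hs, mem_univ _⟩

theorem hasFDerivWithinAt_slab (hΦ : ContDiffOn ℝ ∞ Φ (Icc a b ×ˢ univ)) (ht : t ∈ Icc a b) :
    HasFDerivWithinAt Φ (fderivWithin ℝ Φ (Icc a b ×ˢ univ) (t, x)) (Icc a b ×ˢ univ) (t, x) :=
  (hΦ.differentiableOn (by simp) (t, x) ⟨ht, mem_univ _⟩).hasFDerivWithinAt

theorem hasFDerivAt_slice {Φ' : ℝ × E →L[ℝ] G}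
    (h : HasFDerivWithinAt Φ Φ' (Icc a b ×ˢ univ) (t, x)) (ht : t ∈ Icc a b) :
    HasFDerivAt (fun y => Φ (t, y)) (Φ'.comp (ContinuousLinearMap.inr ℝ ℝ E)) x := by
  rw [← hasFDerivWithinAt_univ]
  exact h.comp x (hasFDerivAt_prodMk_right t x).hasFDerivWithinAt
    fun y _ => ⟨ht, mem_univ _⟩

theorem hasDerivWithinAt_line {Φ' : ℝ × E →L[ℝ] G}
    (h : HasFDerivWithinAt Φ Φ' (Icc a b ×ˢ univ) (t, x)) :
    HasDerivWithinAt (fun s => Φ (s, x)) (Φ' (1, 0)) (Icc a b) t :=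
  HasFDerivWithinAt.comp_hasDerivWithinAt (f := fun s : ℝ => (s, x)) t h
    ((hasDerivWithinAt_id t _).prodMk (hasDerivWithinAt_const t _ x))
    fun _ hs => ⟨hs, mem_univ _⟩

/-- The total derivative splits into its time and space parts; uniqueness of one-sided derivatives
identifies the time part with `w`. -/
theorem hasDerivWithinAt_curve (hΦ : ContDiffOn ℝ ∞ Φ (Icc a b ×ˢ univ)) (hab : a < b)
    (ht : t ∈ Icc a b) {c : ℝ → E} {c' : E} {w : G} (hc : HasDerivWithinAt c c' (Icc a b) t)
    (hw : HasDerivWithinAt (fun s => Φ (s, c t)) w (Icc a b) t) :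
    HasDerivWithinAt (fun s => Φ (s, c s)) (w + fderiv ℝ (fun y => Φ (t, y)) (c t) c')
      (Icc a b) t := by
  have h := hasFDerivWithinAt_slab (x := c t) hΦ ht
  have h1 := HasFDerivWithinAt.comp_hasDerivWithinAt (f := fun s : ℝ => (s, c s)) t h
    ((hasDerivWithinAt_id t _).prodMk hc) fun _ hs => ⟨hs, mem_univ _⟩
  have h2 := (uniqueDiffOn_Icc hab t ht).eq_deriv _ (hasDerivWithinAt_line h) hw
  have e : w + fderiv ℝ (fun y => Φ (t, y)) (c t) c' =
      fderivWithin ℝ Φ (Icc a b ×ˢ univ) (t, c t) (1, c') := by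
    rw [(hasFDerivAt_slice h ht).fderiv, ← h2, ContinuousLinearMap.comp_apply,
      ContinuousLinearMap.inr_apply, ← map_add]
    simp
  rw [e]
  exact h1

end Slab

/-! ### Symplectic linear algebra and symplectic diffeomorphisms -/

variable {n : ℕ}

/-- The standard symplectic form as a continuous bilinear map. -/
def omegaCLM (n : ℕ) : Phase n →L[ℝ] Phase n →L[ℝ] ℝ :=
  LinearMap.toContinuousLinearMap (LinearMap.toContinuousLinearMap.toLinearMap ∘ₗ
    LinearMap.mk₂ ℝ (omega (n := n))
      (fun u v w => by
        simp only [omega, PiLp.add_apply, ← Finset.sum_add_distrib]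
        exact Finset.sum_congr rfl fun _ _ => by ring)
      (fun c u v => by
        simp only [omega, PiLp.smul_apply, smul_eq_mul, Finset.mul_sum]
        exact Finset.sum_congr rfl fun _ _ => by ring)
      (fun u v w => by
        simp only [omega, PiLp.add_apply, ← Finset.sum_add_distrib]
        exact Finset.sum_congr rfl fun _ _ => by ring)
      (fun c u v => by
        simp only [omega, PiLp.smul_apply, smul_eq_mul, Finset.mul_sum]
        exact Finset.sum_congr rfl fun _ _ => by ring))

@[simp] theorem omegaCLM_apply (u v : Phase n) : omegaCLM n u v = omega u v := rfl

/-- The symplectic gradient of a linear form. -/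
def sgrad (n : ℕ) : (Phase n →L[ℝ] ℝ) →L[ℝ] Phase n :=
  LinearMap.toContinuousLinearMap
    { toFun := fun L => WithLp.toLp 2 (Sum.elim
        (fun j => L (EuclideanSpace.single (Sum.inr j) 1))
        (fun j => - L (EuclideanSpace.single (Sum.inl j) 1)))
      map_add' := fun L M => by
        ext i; rcases i with i | i <;> simp [add_comm]
      map_smul' := fun c L => by
        ext i; rcases i with i | i <;> simp }

theorem hamField_eq (G : Phase n → ℝ) (x : Phase n) : hamField G x = sgrad n (fderiv ℝ G x) := rfl

theorem omega_sgrad (L : Phase n →L[ℝ] ℝ) (v : Phase n) : omega (sgrad n L) v = - L v := by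
  simpa [hamField_eq] using omega_hamField (fun x => L x) 0 v

theorem omega_skew (u v : Phase n) : omega u v = - omega v u := by
  simp only [omega, ← Finset.sum_neg_distrib]
  exact Finset.sum_congr rfl fun _ _ => by ring

theorem omega_left_injective {u u' : Phase n} (h : ∀ v, omega u v = omega u' v) : u = u' := by
  ext i
  rcases i with i | i
  · have := h (EuclideanSpace.single (Sum.inr i) 1)
    simpa [omega] using this
  · have := h (EuclideanSpace.single (Sum.inl i) 1)
    simpa [omega] using this

theorem sgrad_ne_zero {L : Phase n →L[ℝ] ℝ} (hL : L ≠ 0) : sgrad n L ≠ 0 := by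
  intro h
  apply hL
  ext v
  have := omega_sgrad L v
  rw [h] at this
  simp [omega] at this
  simp [this]

/-- `φ` is a symplectic diffeomorphism. -/
structure IsSymp (φ : Equiv.Perm (Phase n)) : Prop where
  smooth : ContDiff ℝ ∞ φ
  smooth_symm : ContDiff ℝ ∞ φ.symm
  omega_fderiv : ∀ x u v, omega (fderiv ℝ φ x u) (fderiv ℝ φ x v) = omega u v

namespace IsSymp

variable {φ ψ : Equiv.Perm (Phase n)}

theorem differentiableAt (h : IsSymp φ) (x : Phase n) : DifferentiableAt ℝ φ x :=
  h.smooth.differentiable (by simp) x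

theorem differentiableAt_symm (h : IsSymp φ) (x : Phase n) : DifferentiableAt ℝ φ.symm x :=
  h.smooth_symm.differentiable (by simp) x

theorem fderiv_fderiv_symm (h : IsSymp φ) (x u : Phase n) :
    fderiv ℝ φ x (fderiv ℝ φ.symm (φ x) u) = u := by
  have h1 : HasFDerivAt (φ ∘ φ.symm) ((fderiv ℝ φ x).comp (fderiv ℝ φ.symm (φ x))) (φ x) := by
    refine HasFDerivAt.comp (φ x) ?_ (h.differentiableAt_symm _).hasFDerivAt
    rw [φ.symm_apply_apply]
    exact (h.differentiableAt x).hasFDerivAt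
  have h2 : (φ ∘ φ.symm : Phase n → Phase n) = id := by ext1 y; simp
  rw [h2] at h1
  have := h1.unique (hasFDerivAt_id (φ x))
  exact DFunLike.congr_fun this u

theorem eq_zero_of_fderiv_eq_zero (h : IsSymp φ) {x u : Phase n} (hu : fderiv ℝ φ x u = 0) :
    u = 0 := by
  refine omega_left_injective fun v => ?_
  rw [← h.omega_fderiv x, hu]
  simp [omega]

theorem one : IsSymp (1 : Equiv.Perm (Phase n)) where
  smooth := contDiff_id
  smooth_symm := contDiff_id
  omega_fderiv x u v := by
    have : fderiv ℝ (⇑(1 : Equiv.Perm (Phase n))) x = ContinuousLinearMap.id ℝ _ := fderiv_id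
    simp

theorem mul (h : IsSymp φ) (h' : IsSymp ψ) : IsSymp (φ * ψ) where
  smooth := h.smooth.comp h'.smooth
  smooth_symm := h'.smooth_symm.comp h.smooth_symm
  omega_fderiv x u v := by
    have : fderiv ℝ (⇑(φ * ψ)) x = (fderiv ℝ φ (ψ x)).comp (fderiv ℝ ψ x) :=
      fderiv_comp x (h.differentiableAt _) (h'.differentiableAt x)
    rw [this, ContinuousLinearMap.comp_apply, ContinuousLinearMap.comp_apply, h.omega_fderiv,
      h'.omega_fderiv]

theorem inv (h : IsSymp φ) : IsSymp φ⁻¹ where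
  smooth := h.smooth_symm
  smooth_symm := h.smooth
  omega_fderiv x u v := by
    obtain ⟨y, rfl⟩ := φ.surjective x
    rw [← h.omega_fderiv y]
    change omega (fderiv ℝ φ y (fderiv ℝ φ.symm (φ y) u))
      (fderiv ℝ φ y (fderiv ℝ φ.symm (φ y) v)) = _
    rw [h.fderiv_fderiv_symm, h.fderiv_fderiv_symm]

theorem pow (h : IsSymp φ) (j : ℕ) : IsSymp (φ ^ j) := by
  induction j with
  | zero => exact one
  | succ j ih => rw [pow_succ]; exact ih.mul h

theorem fderiv_hamField (h : IsSymp φ) {G : Phase n → ℝ} {x : Phase n}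
    (hG : DifferentiableAt ℝ G x) :
    fderiv ℝ φ x (hamField G x) = hamField (fun y => G (φ.symm y)) (φ x) := by
  apply omega_left_injective
  intro v
  have h1 : HasFDerivAt (fun y => G (φ.symm y))
      ((fderiv ℝ G x).comp (fderiv ℝ φ.symm (φ x))) (φ x) := by
    refine HasFDerivAt.comp (φ x) ?_ (h.differentiableAt_symm _).hasFDerivAt
    rw [φ.symm_apply_apply]
    exact hG.hasFDerivAt
  rw [omega_hamField, h1.fderiv, ← h.fderiv_fderiv_symm x v, h.omega_fderiv, omega_hamField,
    h.fderiv_fderiv_symm]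
  rfl

end IsSymp

/-- Hamiltonian fields are infinitesimally symplectic: the two terms are values of the second
derivative of `G` with swapped arguments, and they cancel by its symmetry. -/
theorem omega_fderiv_hamField_add {G : Phase n → ℝ} (hG : ContDiff ℝ ∞ G) (x u v : Phase n) :
    omega (fderiv ℝ (hamField G) x u) v + omega u (fderiv ℝ (hamField G) x v) = 0 := by
  have h1 : HasFDerivAt (hamField G) ((sgrad n).comp (fderiv ℝ (fderiv ℝ G) x)) x :=
    (sgrad n).hasFDerivAt.comp x
      ((hG.fderiv_right (m := ∞) (by simp)).differentiable (by simp) x).hasFDerivAt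
  rw [h1.fderiv, omega_skew u]
  simp only [ContinuousLinearMap.comp_apply, omega_sgrad]
  have : IsSymmSndFDerivAt ℝ G x := hG.contDiffAt.isSymmSndFDerivAt
    (by simpa using two_le_infty)
  rw [this.eq u v]
  ring

/-! ### Families generated by Hamiltonians: symplecticity, composition, conjugation,
reparametrization -/

section

variable {n : ℕ} {a b : ℝ} {F G : ℝ → Phase n → ℝ} {f g : ℝ → Equiv.Perm (Phase n)}

theorem IsNormalized.contDiff (hF : IsNormalized a b F) {t : ℝ} (ht : t ∈ Icc a b) :
    ContDiff ℝ ∞ (F t) := contDiff_slice hF.smooth ht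

theorem IsGeneratedBy.contDiff (hf : IsGeneratedBy a b F f) {t : ℝ} (ht : t ∈ Icc a b) :
    ContDiff ℝ ∞ (f t) := contDiff_slice hf.smooth ht

theorem IsGeneratedBy.congr (hf : IsGeneratedBy a b F f) (hF : ∀ t ∈ Icc a b, F t = G t)
    (hg : ∀ t ∈ Icc a b, f t = g t) : IsGeneratedBy a b G g where
  smooth := hf.smooth.congr fun z hz => by rw [hg z.1 hz.1]
  smooth_symm := hf.smooth_symm.congr fun z hz => by rw [hg z.1 hz.1]
  ode t ht x := by
    rw [← hF t ht, ← hg t ht]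
    exact (hf.ode t ht x).congr (fun s hs => by rw [hg s hs]) (by rw [hg t ht])

theorem IsNormalized.congr (hF : IsNormalized a b F) (h : ∀ t ∈ Icc a b, F t = G t) :
    IsNormalized a b G where
  smooth := hF.smooth.congr fun z hz => by rw [h z.1 hz.1]
  compact := by
    obtain ⟨K, hK, h0⟩ := hF.compact
    exact ⟨K, hK, fun t ht => by rw [← h t ht]; exact h0 t ht⟩

/-- The variational equation. -/
theorem IsGeneratedBy.hasDerivWithinAt_fderiv (hab : a < b) (hF : IsNormalized a b F)
    (hf : IsGeneratedBy a b F f) {t : ℝ} (ht : t ∈ Icc a b) (x u : Phase n) :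
    HasDerivWithinAt (fun s => fderiv ℝ (f s) x u)
      (fderiv ℝ (hamField (F t)) (f t x) (fderiv ℝ (f t) x u)) (Icc a b) t := by
  set S : Set (ℝ × Phase n) := Icc a b ×ˢ univ
  set Φ : ℝ × Phase n → Phase n := fun z => f z.1 z.2
  have hS : UniqueDiffOn ℝ S := uniqueDiffOn_slab hab
  have hΦ : ContDiffOn ℝ ∞ Φ S := hf.smooth
  have hD : ContDiffOn ℝ ∞ (fderivWithin ℝ Φ S) S := hΦ.fderivWithin hS (by simp)
  have hzS : (t, x) ∈ S := ⟨ht, mem_univ _⟩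
  have hslice : ∀ s ∈ Icc a b, ∀ y w, fderiv ℝ (f s) y w = fderivWithin ℝ Φ S (s, y) (0, w) := by
    intro s hs y w
    rw [(hasFDerivAt_slice (hasFDerivWithinAt_slab hΦ hs) hs : HasFDerivAt (f s) _ y).fderiv]
    rfl
  have hline : ∀ y, fderivWithin ℝ Φ S (t, y) (1, 0) = hamField (F t) (f t y) := fun y =>
    (uniqueDiffOn_Icc hab t ht).eq_deriv _
      (hasDerivWithinAt_line (hasFDerivWithinAt_slab hΦ ht)) (hf.ode t ht y)
  have hD' := hasFDerivWithinAt_slab (x := x) hD ht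
  have h1 : HasDerivWithinAt (fun s => fderivWithin ℝ Φ S (s, x) (0, u))
      (fderivWithin ℝ (fderivWithin ℝ Φ S) S (t, x) (1, 0) (0, u)) (Icc a b) t := by
    simpa using (hasDerivWithinAt_line hD').clm_apply (hasDerivWithinAt_const t _ ((0 : ℝ), u))
  -- Time and space derivatives commute even at the end times, because every point of the slab is a
  -- limit of interior points.
  have hsymm : IsSymmSndFDerivWithinAt ℝ Φ S (t, x) := by
    refine (hΦ (t, x) hzS).isSymmSndFDerivWithinAt (by simpa using two_le_infty) hS ?_ hzS
    rw [interior_prod_eq, closure_prod_eq, interior_Icc, closure_Ioo hab.ne, interior_univ,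
      closure_univ]
    exact hzS
  have h2 : HasFDerivAt (fun y => fderivWithin ℝ Φ S (t, y) (1, 0))
      (((fderivWithin ℝ (fderivWithin ℝ Φ S) S (t, x)).comp
        (ContinuousLinearMap.inr ℝ ℝ (Phase n))).flip (1, 0)) x := by
    simpa using (hasFDerivAt_slice hD' ht).clm_apply (hasFDerivAt_const ((1 : ℝ), (0 : Phase n)) x)
  have h3 : HasFDerivAt (fun y => hamField (F t) (f t y))
      ((fderiv ℝ (hamField (F t)) (f t x)).comp (fderiv ℝ (f t) x)) x := by
    have : ContDiff ℝ ∞ (hamField (F t)) :=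
      (sgrad n).contDiff.comp ((hF.contDiff ht).fderiv_right (by simp))
    exact ((this.differentiable (by simp)) _).hasFDerivAt.comp x
      ((hf.contDiff ht).differentiable (by simp) x).hasFDerivAt
  simp only [hline] at h2
  have h4 := DFunLike.congr_fun (h2.unique h3) u
  simp only [ContinuousLinearMap.flip_apply, ContinuousLinearMap.comp_apply,
    ContinuousLinearMap.inr_apply] at h4
  rw [← h4, ← hsymm.eq]
  exact h1.congr (fun s hs => hslice s hs x u) (hslice t ht x u)

/-- By the variational equation and `omega_fderiv_hamField_add`, the pulled-back form is constant in
time. -/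
theorem IsGeneratedBy.isSymp (hab : a < b) (hF : IsNormalized a b F)
    (hf : IsGeneratedBy a b F f) (ha : IsSymp (f a)) {t : ℝ} (ht : t ∈ Icc a b) :
    IsSymp (f t) where
  smooth := hf.contDiff ht
  smooth_symm := contDiff_slice hf.smooth_symm ht
  omega_fderiv x u v := by
    have key : ∀ s ∈ Icc a b, HasDerivWithinAt
        (fun s => omegaCLM n (fderiv ℝ (f s) x u) (fderiv ℝ (f s) x v)) 0 (Icc a b) s := by
      intro s hs
      have := (omegaCLM n).hasDerivWithinAt_of_bilinear
        (hf.hasDerivWithinAt_fderiv hab hF hs x u) (hf.hasDerivWithinAt_fderiv hab hF hs x v)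
      exact this.congr_deriv
        ((add_comm _ _).trans (omega_fderiv_hamField_add (hF.contDiff hs) _ _ _))
    have := constant_of_derivWithin_zero (fun s hs => (key s hs).differentiableWithinAt)
      (fun s hs => (key s (Ico_subset_Icc_self hs)).derivWithin
        (uniqueDiffOn_Icc hab s (Ico_subset_Icc_self hs))) t ht
    simp only [omegaCLM_apply] at this
    rw [this, ha.omega_fderiv]

theorem IsNormalized.add_comp_symm (hF : IsNormalized a b F) (hf : IsGeneratedBy a b F f)
    (hG : IsNormalized a b G) : IsNormalized a b fun t x => F t x + G t ((f t).symm x) where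
  smooth := hF.smooth.add (hG.smooth.comp (contDiff_fst.contDiffOn.prodMk hf.smooth_symm)
    fun z hz => ⟨hz.1, mem_univ _⟩)
  compact := by
    obtain ⟨K, hK, hK0⟩ := hF.compact
    obtain ⟨L, hL, hL0⟩ := hG.compact
    refine ⟨K ∪ (fun z : ℝ × Phase n => f z.1 z.2) '' (Icc a b ×ˢ L), hK.union
      ((isCompact_Icc.prod hL).image_of_continuousOn
        (hf.smooth.continuousOn.mono (prod_mono_right (subset_univ _)))), fun t ht x hx => ?_⟩
    rw [hK0 t ht x fun h => hx (Or.inl h), zero_add]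
    exact hL0 t ht _ fun h => hx (Or.inr ⟨(t, (f t).symm x), ⟨ht, h⟩, by simp⟩)

/-- The velocity of the composition is that of `f` plus the image under `Df` of that of `g`; a
symplectic map carries Hamiltonian fields to Hamiltonian fields. -/
theorem IsGeneratedBy.mul (hab : a < b) (hF : IsNormalized a b F) (hf : IsGeneratedBy a b F f)
    (hs : ∀ t ∈ Icc a b, IsSymp (f t)) (hG : IsNormalized a b G) (hg : IsGeneratedBy a b G g) :
    IsGeneratedBy a b (fun t x => F t x + G t ((f t).symm x)) fun t => f t * g t where
  smooth := hf.smooth.comp (contDiff_fst.contDiffOn.prodMk hg.smooth)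
    fun z hz => ⟨hz.1, mem_univ _⟩
  smooth_symm := hg.smooth_symm.comp (contDiff_fst.contDiffOn.prodMk hf.smooth_symm)
    fun z hz => ⟨hz.1, mem_univ _⟩
  ode t ht x := by
    have h := hasDerivWithinAt_curve hf.smooth hab ht (hg.ode t ht x) (hf.ode t ht (g t x))
    have hGt := (hG.contDiff ht).differentiable (by simp)
    have hFt := (hF.contDiff ht).differentiable (by simp)
    have e : hamField (fun x => F t x + G t ((f t).symm x)) (f t (g t x)) =
        hamField (F t) (f t (g t x)) + hamField (fun x => G t ((f t).symm x)) (f t (g t x)) := by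
      rw [hamField_eq, fderiv_fun_add (hFt _)
        (show DifferentiableAt ℝ (fun x => G t ((f t).symm x)) _ from
          (hGt _).comp _ ((hs t ht).differentiableAt_symm _)), map_add]
      rfl
    change HasDerivWithinAt (fun s => f s (g s x)) (hamField _ (f t (g t x))) _ _
    rw [e, ← (hs t ht).fderiv_hamField (hGt _)]
    exact h

theorem IsGeneratedBy.mul_right (hf : IsGeneratedBy a b F f) {φ : Equiv.Perm (Phase n)}
    (hφ : IsSymp φ) : IsGeneratedBy a b F fun t => f t * φ where
  smooth := hf.smooth.comp
    (contDiff_fst.contDiffOn.prodMk (hφ.smooth.comp contDiff_snd).contDiffOn)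
    fun _ hz => ⟨hz.1, mem_univ _⟩
  smooth_symm := hφ.smooth_symm.comp_contDiffOn hf.smooth_symm
  ode t ht x := hf.ode t ht (φ x)

theorem IsNormalized.comp_symm (hF : IsNormalized a b F) {φ : Equiv.Perm (Phase n)}
    (hφ : IsSymp φ) : IsNormalized a b fun t x => F t (φ.symm x) where
  smooth := hF.smooth.comp
    (contDiff_fst.contDiffOn.prodMk (hφ.smooth_symm.comp contDiff_snd).contDiffOn)
    fun z hz => ⟨hz.1, mem_univ _⟩
  compact := by
    obtain ⟨K, hK, hK0⟩ := hF.compact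
    exact ⟨φ '' K, hK.image hφ.smooth.continuous, fun t ht x hx =>
      hK0 t ht _ fun h => hx ⟨_, h, by simp⟩⟩

theorem IsGeneratedBy.conj (hF : IsNormalized a b F) (hf : IsGeneratedBy a b F f)
    {φ : Equiv.Perm (Phase n)} (hφ : IsSymp φ) :
    IsGeneratedBy a b (fun t x => F t (φ.symm x)) fun t => φ * f t * φ⁻¹ where
  smooth := hφ.smooth.comp_contDiffOn (hf.mul_right hφ.inv).smooth
  smooth_symm := by
    have h : ContDiffOn ℝ ∞ (fun z : ℝ × Phase n => (f z.1).symm (φ.symm z.2))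
        (Icc a b ×ˢ univ) :=
      hf.smooth_symm.comp
        (contDiff_fst.contDiffOn.prodMk (hφ.smooth_symm.comp contDiff_snd).contDiffOn)
        fun _ hz => ⟨hz.1, mem_univ _⟩
    exact hφ.smooth.comp_contDiffOn h
  ode t ht x := by
    have h := (hφ.differentiableAt (f t (φ.symm x))).hasFDerivAt.comp_hasDerivWithinAt t
      (hf.ode t ht (φ.symm x))
    rw [hφ.fderiv_hamField ((hF.contDiff ht).differentiable (by simp) _)] at h
    exact h

theorem mapsTo_affine {μ lam a' b' : ℝ} (he : MapsTo (fun s => μ + lam * s) (Icc a' b') (Icc a b)) :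
    MapsTo (fun z : ℝ × Phase n => (μ + lam * z.1, z.2)) (Icc a' b' ×ˢ univ) (Icc a b ×ˢ univ) :=
  fun _ hz => ⟨he hz.1, mem_univ _⟩

theorem IsNormalized.reparam {μ lam a' b' : ℝ} (hF : IsNormalized a b F)
    (he : MapsTo (fun s => μ + lam * s) (Icc a' b') (Icc a b)) :
    IsNormalized a' b' fun s x => lam * F (μ + lam * s) x where
  smooth := contDiffOn_const.mul (hF.smooth.comp (ContDiff.contDiffOn (by fun_prop))
    (mapsTo_affine he))
  compact := by
    obtain ⟨K, hK, hK0⟩ := hF.compact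
    exact ⟨K, hK, fun t ht x hx => by rw [hK0 _ (he ht) x hx, mul_zero]⟩

theorem IsGeneratedBy.reparam {μ lam a' b' : ℝ} (hF : IsNormalized a b F)
    (hf : IsGeneratedBy a b F f)
    (he : MapsTo (fun s => μ + lam * s) (Icc a' b') (Icc a b)) :
    IsGeneratedBy a' b' (fun s x => lam * F (μ + lam * s) x) fun s => f (μ + lam * s) where
  smooth := hf.smooth.comp (ContDiff.contDiffOn (by fun_prop)) (mapsTo_affine he)
  smooth_symm := hf.smooth_symm.comp (ContDiff.contDiffOn (by fun_prop)) (mapsTo_affine he)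
  ode t ht x := by
    have h1 : HasDerivWithinAt (fun s : ℝ => μ + lam * s) lam (Icc a' b') t := by
      simpa using ((hasDerivWithinAt_id t (Icc a' b')).const_mul lam).const_add μ
    have h2 := (hf.ode _ (he ht) x).scomp t h1 he
    have e : hamField (fun x => lam * F (μ + lam * t) x) (f (μ + lam * t) x) =
        lam • hamField (F (μ + lam * t)) (f (μ + lam * t) x) := by
      rw [hamField_eq, fderiv_const_mul ((hF.contDiff (he ht)).differentiable (by simp) _),
        map_smul]
      rfl
    rw [e]
    exact h2

/-- A point at which the Hamiltonians vanish locally is not moved. -/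
theorem IsGeneratedBy.symm_apply_eq (hab : a < b) (hf : IsGeneratedBy a b F f)
    (hs : ∀ t ∈ Icc a b, IsSymp (f t)) {x : Phase n}
    (hx : ∀ t ∈ Icc a b, hamField (F t) x = 0) {t : ℝ} (ht : t ∈ Icc a b) :
    (f t).symm x = (f a).symm x := by
  -- Differentiating `f_s (f_s⁻¹ x) = x` shows that `Df_s` kills the velocity of `f_s⁻¹ x`, since
  -- the field vanishes at `x`. As `Df_s` is injective, no uniqueness theorem for the flow is
  -- needed.
  have key : ∀ s ∈ Icc a b, HasDerivWithinAt (fun r => (f r).symm x) 0 (Icc a b) s := by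
    intro s hs'
    have h1 := hasDerivWithinAt_line (hasFDerivWithinAt_slab (x := x) hf.smooth_symm hs')
    have h2 := hasDerivWithinAt_curve hf.smooth hab hs' h1 (hf.ode s hs' _)
    simp only [Equiv.apply_symm_apply] at h2
    have h3 := (uniqueDiffOn_Icc hab s hs').eq_deriv _ h2 (hasDerivWithinAt_const s _ x)
    have h4 : hamField (F s) (f s ((f s).symm x)) = 0 := by
      rw [Equiv.apply_symm_apply, hx s hs']
    have h5 := (hs s hs').eq_zero_of_fderiv_eq_zero (by rw [← h3]; erw [h4, zero_add])
    exact h1.congr_deriv h5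
  exact constant_of_derivWithin_zero (fun s hs => (key s hs).differentiableWithinAt)
      (fun s hs => (key s (Ico_subset_Icc_self hs)).derivWithin
        (uniqueDiffOn_Icc hab s (Ico_subset_Icc_self hs))) t ht

end

/-! ### The group `Ham`, oscillation, and paths with bounded time derivatives -/

section

variable {n : ℕ} {a b : ℝ} {F G : ℝ → Phase n → ℝ} {f g : ℝ → Equiv.Perm (Phase n)}
  {φ ψ χ : Equiv.Perm (Phase n)}

theorem isNormalized_zero : IsNormalized a b (fun _ _ => 0 : ℝ → Phase n → ℝ) where
  smooth := contDiffOn_const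
  compact := ⟨∅, isCompact_empty, fun _ _ _ _ => rfl⟩

theorem isGeneratedBy_one : IsGeneratedBy a b (fun _ _ => 0 : ℝ → Phase n → ℝ) fun _ => 1 where
  smooth := contDiff_snd.contDiffOn
  smooth_symm := contDiff_snd.contDiffOn
  ode t ht x := by
    rw [hamField_eq]
    simpa using hasDerivWithinAt_const t (Icc a b) x

theorem IsHamIsotopy.isSymp (hF : IsNormalized 0 1 F) (hf : IsHamIsotopy F f) {t : ℝ}
    (ht : t ∈ Icc (0 : ℝ) 1) : IsSymp (f t) :=
  hf.1.isSymp one_pos hF (hf.2 ▸ IsSymp.one) ht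

theorem isSymp_of_mem_Ham (hφ : φ ∈ Ham n) : IsSymp φ := by
  obtain ⟨H, f, hH, hf, rfl⟩ := hφ
  exact hf.isSymp hH (right_mem_Icc.2 zero_le_one)

theorem one_mem_Ham : (1 : Equiv.Perm (Phase n)) ∈ Ham n :=
  ⟨_, _, isNormalized_zero, ⟨isGeneratedBy_one, rfl⟩, rfl⟩

theorem mul_mem_Ham (hφ : φ ∈ Ham n) (hψ : ψ ∈ Ham n) : φ * ψ ∈ Ham n := by
  obtain ⟨H, f, hH, hf, rfl⟩ := hφ
  obtain ⟨G, g, hG, hg, rfl⟩ := hψ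
  refine ⟨_, fun t => f t * g t, hH.add_comp_symm hf.1 hG, ⟨IsGeneratedBy.mul one_pos hH hf.1
    (fun t ht => hf.isSymp hH ht) hG hg.1, ?_⟩, rfl⟩
  simp [hf.2, hg.2]

theorem inv_mem_Ham (hφ : φ ∈ Ham n) : φ⁻¹ ∈ Ham n := by
  have hs := (isSymp_of_mem_Ham hφ).inv
  obtain ⟨H, f, hH, hf, rfl⟩ := hφ
  have he : MapsTo (fun s : ℝ => 1 + (-1) * s) (Icc 0 1) (Icc 0 1) := fun s hs =>
    ⟨by linarith [hs.2], by linarith [hs.1]⟩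
  refine ⟨_, fun t => f (1 + (-1) * t) * (f 1)⁻¹, hH.reparam he,
    ⟨(hf.1.reparam hH he).mul_right hs, ?_⟩, ?_⟩
  · simp
  · simp [hf.2]

theorem conj_mem_Ham (hφ : φ ∈ Ham n) (hψ : IsSymp ψ) : ψ * φ * ψ⁻¹ ∈ Ham n := by
  obtain ⟨H, f, hH, hf, rfl⟩ := hφ
  refine ⟨_, fun t => ψ * f t * ψ⁻¹, hH.comp_symm hψ, ⟨hf.1.conj hH hψ, ?_⟩, rfl⟩
  simp [hf.2]

theorem IsHamIsotopy.mem_Ham (hF : IsNormalized 0 1 F) (hf : IsHamIsotopy F f) {t : ℝ}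
    (ht : t ∈ Icc (0 : ℝ) 1) : f t ∈ Ham n := by
  have he : MapsTo (fun s : ℝ => 0 + t * s) (Icc 0 1) (Icc 0 1) := fun s hs => by
    change 0 + t * s ∈ _
    rw [zero_add]
    exact ⟨mul_nonneg ht.1 hs.1, mul_le_one₀ ht.2 hs.1 hs.2⟩
  exact ⟨_, _, hF.reparam he, ⟨hf.1.reparam hF he, by simp [hf.2]⟩, by simp⟩

theorem osc_comp_le (G : Phase n → ℝ) (h : Phase n → Phase n) :
    osc (fun x => G (h x)) ≤ osc G :=
  iSup_le fun x => iSup_le fun y =>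
    le_iSup_of_le (h x) (le_iSup (fun z => ENNReal.ofReal (G (h x) - G z)) (h y))

theorem osc_le_of_forall_exists {G G' : Phase n → ℝ} (h : ∀ x, ∃ y, G x = G' y) :
    osc G ≤ osc G' := by
  choose e he using h
  obtain rfl : G = fun x => G' (e x) := funext he
  exact osc_comp_le G' e

theorem osc_const_mul_le (G : Phase n → ℝ) (c : ℝ) :
    osc (fun x => c * G x) ≤ ENNReal.ofReal |c| * osc G := by
  refine iSup_le fun x => iSup_le fun y => ?_
  have key : ∀ x y, ENNReal.ofReal (|c| * (G x - G y)) ≤ ENNReal.ofReal |c| * osc G := by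
    intro x y
    rw [ENNReal.ofReal_mul (abs_nonneg c)]
    exact mul_le_mul_right (le_iSup_of_le x (le_iSup (fun y => ENNReal.ofReal (G x - G y)) y)) _
  rcases abs_cases c with h | h
  · exact (congrArg ENNReal.ofReal (by rw [h.1]; ring)).trans_le (key x y)
  · exact (congrArg ENNReal.ofReal (by rw [h.1]; ring)).trans_le (key y x)

theorem osc_le_of_abs_le {G : Phase n → ℝ} {C : ℝ} (h : ∀ x, |G x| ≤ C) :
    osc G ≤ ENNReal.ofReal (2 * C) :=
  iSup_le fun x => iSup_le fun y => ENNReal.ofReal_le_ofReal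
    (by linarith [(abs_le.1 (h x)).2, (abs_le.1 (h y)).1])

theorem IsNormalized.derivWithin (hab : a < b) (hF : IsNormalized a b F) :
    IsNormalized a b fun t x => derivWithin (fun r => F r x) (Icc a b) t where
  smooth := by
    have h : ContDiffOn ℝ ∞ (fun z : ℝ × Phase n => fderivWithin ℝ
        (fun z : ℝ × Phase n => F z.1 z.2) (Icc a b ×ˢ univ) z (1, 0)) (Icc a b ×ˢ univ) :=
      (hF.smooth.fderivWithin (uniqueDiffOn_slab hab) (by simp)).clm_apply contDiffOn_const
    refine h.congr fun z hz => ?_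
    exact (hasDerivWithinAt_line (hasFDerivWithinAt_slab hF.smooth hz.1)).derivWithin
      (uniqueDiffOn_Icc hab _ hz.1)
  compact := by
    obtain ⟨K, hK, hK0⟩ := hF.compact
    refine ⟨K, hK, fun t ht x hx => ?_⟩
    rw [derivWithin_congr (f := fun _ => (0 : ℝ)) (fun s hs => hK0 s hs x hx) (hK0 t ht x hx)]
    simp

theorem IsNormalized.iteratedDerivWithin (hab : a < b) (hF : IsNormalized a b F) (i : ℕ) :
    IsNormalized a b fun t x => iteratedDerivWithin i (fun r => F r x) (Icc a b) t := by
  induction i with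
  | zero => simpa using hF
  | succ i ih => simpa only [iteratedDerivWithin_succ] using ih.derivWithin hab

theorem IsNormalized.exists_bound (hF : IsNormalized a b F) :
    ∃ C, ∀ t ∈ Icc a b, ∀ x, |F t x| ≤ C := by
  obtain ⟨K, hK, hK0⟩ := hF.compact
  obtain ⟨C, hC⟩ := (isCompact_Icc.prod hK).exists_bound_of_continuousOn
    (hF.smooth.continuousOn.mono (prod_mono_right (subset_univ _)))
  refine ⟨max C 0, fun t ht x => ?_⟩
  by_cases hx : x ∈ K
  · exact (hC (t, x) ⟨ht, hx⟩).trans (le_max_left _ _)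
  · simp [hK0 t ht x hx]

theorem iteratedDerivWithin_comp_affine {h : ℝ → ℝ} (hab : a < b)
    (hh : ContDiffOn ℝ ∞ h (Icc a b)) {μ lam a' b' : ℝ} (hab' : a' < b')
    (he : MapsTo (fun s => μ + lam * s) (Icc a' b') (Icc a b)) (i : ℕ) {s : ℝ}
    (hs : s ∈ Icc a' b') :
    iteratedDerivWithin i (fun r => h (μ + lam * r)) (Icc a' b') s =
      lam ^ i * iteratedDerivWithin i h (Icc a b) (μ + lam * s) := by
  induction i generalizing s with
  | zero => simp
  | succ i ih =>
    rw [iteratedDerivWithin_succ, derivWithin_congr (fun r hr => ih hr) (ih hs)]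
    have h1 : HasDerivWithinAt (fun s : ℝ => μ + lam * s) lam (Icc a' b') s := by
      simpa using ((hasDerivWithinAt_id s (Icc a' b')).const_mul lam).const_add μ
    have h2 : HasDerivWithinAt (iteratedDerivWithin i h (Icc a b))
        (iteratedDerivWithin (i + 1) h (Icc a b) (μ + lam * s)) (Icc a b) (μ + lam * s) := by
      rw [iteratedDerivWithin_succ]
      exact (hh.differentiableOn_iteratedDerivWithin (by exact_mod_cast WithTop.coe_lt_top i)
        (uniqueDiffOn_Icc hab) _ (he hs)).hasDerivWithinAt
    have h3 := ((h2.comp s h1 he).const_mul (lam ^ i)).derivWithin (uniqueDiffOn_Icc hab' s hs)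
    refine h3.trans ?_
    ring

/-- The chain rule gives `lam ^ i`; the further factor is the one by which a change of speed
multiplies the Hamiltonian. -/
theorem IsNormalized.iteratedDerivWithin_reparam (hab : a < b) (hF : IsNormalized a b F)
    {μ lam a' b' : ℝ} (hab' : a' < b')
    (he : MapsTo (fun s => μ + lam * s) (Icc a' b') (Icc a b)) (i : ℕ) {s : ℝ}
    (hs : s ∈ Icc a' b') (x : Phase n) :
    _root_.iteratedDerivWithin i (fun r => lam * F (μ + lam * r) x) (Icc a' b') s =
      lam ^ (i + 1) *
        _root_.iteratedDerivWithin i (fun r => F r x) (Icc a b) (μ + lam * s) := by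
  have h := iteratedDerivWithin_comp_affine (h := fun r => lam * F r x) hab
    (contDiffOn_const.mul (contDiffOn_line hF.smooth x)) hab' he i hs
  rw [h, iteratedDerivWithin_const_mul_field]
  ring

/-- `Reach B c a b φ ψ`: there is a piecewise smooth path in `Ham` over `[a, b]` from `φ` to `ψ`
whose Hamiltonians vanish off `B` and have `i`-th time derivative of oscillation at most `c i`. -/
inductive Reach (B : Set (Phase n)) (c : ℕ → ℝ≥0∞) :
    ℝ → ℝ → Equiv.Perm (Phase n) → Equiv.Perm (Phase n) → Prop
  | piece {a b : ℝ} {F : ℝ → Phase n → ℝ} {f : ℝ → Equiv.Perm (Phase n)} (hab : a < b)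
      (hF : IsNormalized a b F) (hf : IsGeneratedBy a b F f) (hm : ∀ s ∈ Icc a b, f s ∈ Ham n)
      (hB : ∀ s ∈ Icc a b, ∀ x, x ∉ B → F s x = 0)
      (hc : ∀ i, ∀ s ∈ Icc a b,
        osc (fun x => iteratedDerivWithin i (fun r => F r x) (Icc a b) s) ≤ c i) :
      Reach B c a b (f a) (f b)
  | trans {a b d : ℝ} {φ ψ χ : Equiv.Perm (Phase n)} (h : Reach B c a b φ ψ)
      (h' : Reach B c b d ψ χ) : Reach B c a d φ χ

namespace Reach

variable {B B' : Set (Phase n)} {c c' : ℕ → ℝ≥0∞}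

theorem mono (h : Reach B c a b φ ψ) (hB : B ⊆ B') (hc : ∀ i, c i ≤ c' i) :
    Reach B' c' a b φ ψ := by
  induction h with
  | piece hab hF hf hm hB' hc' =>
    exact piece hab hF hf hm (fun s hs x hx => hB' s hs x fun h => hx (hB h))
      fun i s hs => (hc' i s hs).trans (hc i)
  | trans _ _ ih ih' => exact ih.trans ih'

theorem mul_right (h : Reach B c a b φ ψ) (hχ : χ ∈ Ham n) :
    Reach B c a b (φ * χ) (ψ * χ) := by
  induction h with
  | piece hab hF hf hm hB hc =>
    exact piece hab hF (hf.mul_right (isSymp_of_mem_Ham hχ))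
      (fun s hs => mul_mem_Ham (hm s hs) hχ) hB hc
  | trans _ _ ih ih' => exact ih.trans ih'

theorem conj (h : Reach B c a b φ ψ) (hχ : IsSymp χ) :
    Reach univ c a b (χ * φ * χ⁻¹) (χ * ψ * χ⁻¹) := by
  induction h with
  | @piece a b F f hab hF hf hm hB hc =>
    exact piece hab (hF.comp_symm hχ) (hf.conj hF hχ) (fun s hs => conj_mem_Ham (hm s hs) hχ)
      (fun _ _ _ h => absurd (mem_univ _) h)
      fun i s hs => (osc_comp_le
        (fun x => iteratedDerivWithin i (fun r => F r x) (Icc a b) s) χ.symm).trans (hc i s hs)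
  | trans _ _ ih ih' => exact ih.trans ih'

theorem osc_reparam (hab : a < b) (hF : IsNormalized a b F) {μ lam a' b' : ℝ} (hab' : a' < b')
    (he : MapsTo (fun s => μ + lam * s) (Icc a' b') (Icc a b)) {i : ℕ} {C : ℝ≥0∞}
    (hc : ∀ s ∈ Icc a b,
      osc (fun x => iteratedDerivWithin i (fun r => F r x) (Icc a b) s) ≤ C)
    {s : ℝ} (hs : s ∈ Icc a' b') :
    osc (fun x => iteratedDerivWithin i (fun r => lam * F (μ + lam * r) x) (Icc a' b') s) ≤
      ENNReal.ofReal |lam ^ (i + 1)| * C := by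
  simp only [hF.iteratedDerivWithin_reparam hab hab' he i hs]
  exact (osc_const_mul_le _ _).trans (mul_le_mul_right (hc _ (he hs)) _)

theorem reparam (h : Reach B c a b φ ψ) {lam : ℝ} (hl : 0 < lam) (μ : ℝ) :
    Reach B (fun i => ENNReal.ofReal |lam ^ (i + 1)| * c i) ((a - μ) / lam) ((b - μ) / lam) φ ψ := by
  induction h with
  | @piece a b F f hab hF hf hm hB hc =>
    have he : MapsTo (fun s => μ + lam * s) (Icc ((a - μ) / lam) ((b - μ) / lam)) (Icc a b) := by
      intro s hs
      have h1 := (div_le_iff₀' hl).1 hs.1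
      have h2 := (le_div_iff₀' hl).1 hs.2
      exact ⟨by linarith, by linarith⟩
    have hab' : (a - μ) / lam < (b - μ) / lam := by gcongr
    have key := piece (B := B) hab' (hF.reparam he) (hf.reparam hF he) (fun s hs => hm _ (he hs))
      (fun s hs x hx => by rw [hB _ (he hs) x hx, mul_zero])
      fun i s hs => osc_reparam hab hF hab' he (hc i) hs
    have e : ∀ r, μ + lam * ((r - μ) / lam) = r := fun r => by field_simp; ring
    simpa only [e] using key
  | trans _ _ ih ih' => exact ih.trans ih'

theorem reverse (h : Reach B c a b φ ψ) : Reach B c (-b) (-a) ψ φ := by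
  induction h with
  | @piece a b F f hab hF hf hm hB hc =>
    have he : MapsTo (fun s : ℝ => 0 + (-1) * s) (Icc (-b) (-a)) (Icc a b) := by
      intro s hs
      exact ⟨by linarith [hs.2], by linarith [hs.1]⟩
    have hab' : -b < -a := neg_lt_neg hab
    have key := piece (B := B) hab' (hF.reparam he) (hf.reparam hF he) (fun s hs => hm _ (he hs))
      (fun s hs x hx => by rw [hB _ (he hs) x hx, mul_zero])
      (c := c) fun i s hs => by
        simpa [abs_pow] using osc_reparam hab hF hab' he (hc i) hs
    simpa using key
  | trans _ _ ih ih' => exact ih'.trans ih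

theorem mem_Ham_left (h : Reach B c a b φ ψ) : φ ∈ Ham n := by
  induction h with
  | piece hab _ _ hm => exact hm _ (left_mem_Icc.2 hab.le)
  | trans _ _ ih _ => exact ih

/-- Right translation by `φ⁻¹` gives a path from the identity to `φ⁻¹`. Reversing it multiplies
derivatives only by signs, so `c` is unchanged. -/
theorem inv (h : Reach B c 0 1 φ 1) : Reach B c 0 1 φ⁻¹ 1 := by
  have h1 := (h.mul_right (inv_mem_Ham h.mem_Ham_left)).reverse.reparam one_pos (-1)
  simpa using h1

/-- The path goes from `φψ` to `ψ` and then to the identity, each half at double speed. The sum `c i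
+ c' i` merely dominates the larger of the two bounds. -/
theorem mul (h : Reach B c 0 1 φ 1) (h' : Reach B' c' 0 1 ψ 1) :
    Reach univ (fun i => 2 ^ (i + 1) * (c i + c' i)) 0 1 (φ * ψ) 1 := by
  have h1 := ((h.mul_right h'.mem_Ham_left).reparam two_pos 0)
  have h2 := h'.reparam two_pos (-1)
  have e : ∀ i, ENNReal.ofReal |(2 : ℝ) ^ (i + 1)| = 2 ^ (i + 1) := fun i => by
    rw [abs_of_pos (by positivity), ENNReal.ofReal_pow (by norm_num), ENNReal.ofReal_ofNat]
  simp only [e] at h1 h2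
  rw [one_mul, sub_zero, zero_div, sub_zero] at h1
  rw [show (0 - -1 : ℝ) / 2 = 1 / 2 by norm_num, show (1 - -1 : ℝ) / 2 = 1 by norm_num] at h2
  exact (h1.mono (subset_univ _) fun i => mul_le_mul_right le_self_add _).trans
    (h2.mono (subset_univ _) fun i => mul_le_mul_right le_add_self _)

end Reach

end

/-! ### Passage between `HamPath` and `Reach`; supports of maps and paths -/

section

variable {n : ℕ} {a b : ℝ} {F G : ℝ → Phase n → ℝ} {f g : ℝ → Equiv.Perm (Phase n)}
  {φ ψ χ : Equiv.Perm (Phase n)}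

theorem HamPath.exists_reach (γ : HamPath φ ψ) : ∃ B : Set (Phase n), IsCompact B ∧
    Reach B (fun i => ⨆ l : Fin γ.m, ⨆ s ∈ Icc (γ.t l.castSucc) (γ.t l.succ),
      osc (fun x => iteratedDerivWithin i (fun r => γ.F l r x)
        (Icc (γ.t l.castSucc) (γ.t l.succ)) s)) 0 1 φ ψ := by
  choose K hK hK0 using fun l => (γ.normalized l).compact
  refine ⟨⋃ l, K l, isCompact_iUnion hK, ?_⟩
  have hmem : ∀ l, γ.t l ∈ Icc (0 : ℝ) 1 := fun l =>
    ⟨γ.t_zero ▸ γ.strictMono_t.monotone (Fin.zero_le l),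
      γ.t_last ▸ γ.strictMono_t.monotone (Fin.le_last l)⟩
  set c : ℕ → ℝ≥0∞ := fun i => ⨆ l : Fin γ.m, ⨆ s ∈ Icc (γ.t l.castSucc) (γ.t l.succ),
      osc (fun x => iteratedDerivWithin i (fun r => γ.F l r x)
        (Icc (γ.t l.castSucc) (γ.t l.succ)) s) with hc
  have hpiece : ∀ l : Fin γ.m, Reach (⋃ l, K l) c (γ.t l.castSucc) (γ.t l.succ)
      (γ.f (γ.t l.castSucc)) (γ.f (γ.t l.succ)) := fun l =>
    Reach.piece (γ.strictMono_t Fin.castSucc_lt_succ) (γ.normalized l) (γ.generated l)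
      (fun s hs => γ.f_mem s ⟨(hmem _).1.trans hs.1, hs.2.trans (hmem _).2⟩)
      (fun s hs x hx => hK0 l s hs x fun h => hx (mem_iUnion.2 ⟨l, h⟩))
      fun i s hs => le_iSup_of_le l (le_iSup₂_of_le s hs le_rfl)
  have key : ∀ l : Fin (γ.m + 1), l ≠ 0 →
      Reach (⋃ l, K l) c (γ.t 0) (γ.t l) (γ.f (γ.t 0)) (γ.f (γ.t l)) := by
    intro l
    induction l using Fin.induction with
    | zero => intro h; exact absurd rfl h
    | succ l ih =>
      intro _
      by_cases h : l.castSucc = 0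
      · simpa [h] using hpiece l
      · exact (ih h).trans (hpiece l)
  -- A division from `0` to `1` has at least one piece, whereas `Reach` has no constructor for an
  -- empty path.
  have h0 : Fin.last γ.m ≠ 0 := by
    intro h
    have h1 := γ.t_last
    rw [h, γ.t_zero] at h1
    exact zero_ne_one h1
  simpa [γ.t_zero, γ.t_last, γ.f_zero, γ.f_one] using key _ h0


namespace Reach

variable {B : Set (Phase n)} {c : ℕ → ℝ≥0∞}

/-- Concatenation glues the divisions and the families at the common time `b`, where both equal the
middle map; no smoothness across `b` is asked for. -/
theorem exists_division (h : Reach B c a b φ ψ) : ∃ (m : ℕ) (t : ℕ → ℝ)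
    (f : ℝ → Equiv.Perm (Phase n)) (F : ℕ → ℝ → Phase n → ℝ),
    (∀ l < m, t l < t (l + 1)) ∧ t 0 = a ∧ t m = b ∧ (∀ l ≤ m, t l ∈ Icc a b) ∧
    f a = φ ∧ f b = ψ ∧ (∀ s ∈ Icc a b, f s ∈ Ham n) ∧
    ∀ l < m, IsNormalized (t l) (t (l + 1)) (F l) ∧ IsGeneratedBy (t l) (t (l + 1)) (F l) f ∧
      ∀ i, ∀ s ∈ Icc (t l) (t (l + 1)), osc (fun x =>
        iteratedDerivWithin i (fun r => F l r x) (Icc (t l) (t (l + 1))) s) ≤ c i := by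
  induction h with
  | @piece a b F f hab hF hf hm _ hc =>
    refine ⟨1, fun l => if l = 0 then a else b, f, fun _ => F, ?_, by simp, by simp, ?_, rfl, rfl,
      hm, ?_⟩
    · intro l hl
      obtain rfl : l = 0 := by omega
      simpa using hab
    · intro l _
      dsimp only
      split_ifs
      exacts [left_mem_Icc.2 hab.le, right_mem_Icc.2 hab.le]
    · intro l hl
      obtain rfl : l = 0 := by omega
      simpa using ⟨hF, hf, fun i s h1 h2 => hc i s ⟨h1, h2⟩⟩
  | @trans a b d φ ψ χ _ _ ih ih' =>
    obtain ⟨m, t, f, F, hlt, h0, hm, hI, hfa, hfb, hH, hl⟩ := ih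
    obtain ⟨m', t', f', F', hlt', h0', hm', hI', hfa', hfb', hH', hl'⟩ := ih'
    have hab : a ≤ b := by have := hI 0 (Nat.zero_le _); exact this.1.trans this.2
    have hbd : b ≤ d := by have := hI' 0 (Nat.zero_le _); exact this.1.trans this.2
    set t'' : ℕ → ℝ := fun l => if l ≤ m then t l else t' (l - m) with ht''
    set f'' : ℝ → Equiv.Perm (Phase n) := fun s => if s ≤ b then f s else f' s with hf''
    have e1 : ∀ l ≤ m, t'' l = t l := fun l h => if_pos h
    have e2 : ∀ j, t'' (m + j) = t' j := by
      intro j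
      rcases Nat.eq_zero_or_pos j with rfl | hj
      · rw [add_zero, e1 m le_rfl, hm, h0']
      · simp only [ht'']
        rw [if_neg (by omega), Nat.add_sub_cancel_left]
    have g1 : ∀ s ≤ b, f'' s = f s := fun s h => if_pos h
    have g2 : ∀ s, b ≤ s → f'' s = f' s := by
      intro s h
      rcases h.eq_or_lt with rfl | h
      · rw [g1 _ le_rfl, hfb, hfa']
      · exact if_neg (not_le.2 h)
    refine ⟨m + m', t'', f'', fun l => if l < m then F l else F' (l - m), ?_, ?_, ?_, ?_, ?_, ?_,
      ?_, ?_⟩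
    · intro l hlm
      rcases lt_or_ge l m with h | h
      · rw [e1 l h.le, e1 _ h]; exact hlt l h
      · obtain ⟨j, rfl⟩ := Nat.exists_eq_add_of_le h
        rw [e2, add_assoc, e2]; exact hlt' j (by omega)
    · rw [e1 0 (Nat.zero_le _), h0]
    · rw [e2, hm']
    · intro l hlm
      rcases le_or_gt l m with h | h
      · rw [e1 l h]; exact ⟨(hI l h).1, (hI l h).2.trans hbd⟩
      · obtain ⟨j, rfl⟩ := Nat.exists_eq_add_of_le h.le
        rw [e2]
        exact ⟨hab.trans (hI' j (by omega)).1, (hI' j (by omega)).2⟩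
    · rw [g1 a hab, hfa]
    · rw [g2 d hbd, hfb']
    · intro s hs
      rcases le_total s b with h | h
      · rw [g1 s h]; exact hH s ⟨hs.1, h⟩
      · rw [g2 s h]; exact hH' s ⟨h, hs.2⟩
    · intro l hlm
      rcases lt_or_ge l m with h | h
      · rw [e1 l h.le, e1 _ h]
        simp only [if_pos h]
        refine ⟨(hl l h).1, (hl l h).2.1.congr (fun _ _ => rfl) fun s hs => ?_, (hl l h).2.2⟩
        exact (g1 s (hs.2.trans (hI (l + 1) h).2)).symm
      · obtain ⟨j, rfl⟩ := Nat.exists_eq_add_of_le h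
        have hj : j < m' := by omega
        rw [add_assoc, e2, e2]
        simp only [if_neg (not_lt.2 h), Nat.add_sub_cancel_left]
        refine ⟨(hl' j hj).1, (hl' j hj).2.1.congr (fun _ _ => rfl) fun s hs => ?_,
          (hl' j hj).2.2⟩
        exact (g2 s ((hI' j hj.le).1.trans hs.1)).symm

theorem coarseDist_le (h : Reach B c 0 1 φ ψ) (k : ℕ) :
    coarseDist k φ ψ ≤ ∑ i ∈ Finset.range (k + 1), c i := by
  obtain ⟨m, t, f, F, hlt, h0, hm, _, hfa, hfb, hH, hl⟩ := h.exists_division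
  let γ : HamPath φ ψ :=
    { m := m
      t := fun l => t l
      strictMono_t := Fin.strictMono_iff_lt_succ.2 fun l => hlt l l.2
      t_zero := h0
      t_last := hm
      f := f
      f_mem := hH
      f_zero := hfa
      f_one := hfb
      F := fun l => F l
      normalized := fun l => (hl l l.2).1
      generated := fun l => (hl l l.2).2.1 }
  refine (iInf_le _ γ).trans (Finset.sum_le_sum fun i _ => ?_)
  exact iSup_le fun l => iSup₂_le fun s hs => (hl l l.2).2.2 i s hs

end Reach

/-- `φ` moves only points of `B`. -/
def FixesOff (B : Set (Phase n)) (φ : Equiv.Perm (Phase n)) : Prop := ∀ x, x ∉ B → φ x = x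

namespace FixesOff

variable {B B' : Set (Phase n)}

theorem apply_mem (h : FixesOff B φ) {x : Phase n} (hx : x ∈ B) : φ x ∈ B := by
  by_contra h'
  exact h' ((φ.injective (h _ h')).symm ▸ hx)

theorem mul (h : FixesOff B φ) (h' : FixesOff B ψ) : FixesOff B (φ * ψ) := fun x hx => by
  rw [Equiv.Perm.mul_apply, h' x hx, h x hx]

theorem inv (h : FixesOff B φ) : FixesOff B φ⁻¹ := fun x hx => by
  rw [Equiv.Perm.inv_eq_iff_eq, h x hx]

theorem one : FixesOff B (1 : Equiv.Perm (Phase n)) := fun _ _ => rfl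

/-- Conjugates of `φ` by maps that agree where `φ` moves points coincide. -/
theorem conj_eq (h : FixesOff B φ) (h' : ∀ x ∈ B, ψ x = χ x) :
    ψ * φ * ψ⁻¹ = χ * φ * χ⁻¹ := by
  rw [mul_inv_eq_iff_eq_mul]
  ext1 x
  simp only [Equiv.Perm.mul_apply, Equiv.Perm.coe_inv]
  by_cases hx : x ∈ B
  · rw [h' _ (h.apply_mem hx), h' x hx, Equiv.symm_apply_apply]
  · have hz : χ.symm (ψ x) ∉ B := fun hz => by
      have h1 := h' _ hz
      rw [Equiv.apply_symm_apply] at h1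
      exact hx (ψ.injective h1 ▸ hz)
    rw [h x hx, h _ hz, Equiv.apply_symm_apply]

end FixesOff

theorem hamField_eq_zero {B : Set (Phase n)} (hB : IsClosed B) {G : Phase n → ℝ}
    (hG : ∀ x, x ∉ B → G x = 0) {x : Phase n} (hx : x ∉ B) : hamField G x = 0 := by
  have : G =ᶠ[nhds x] fun _ => (0 : ℝ) :=
    Filter.eventuallyEq_of_mem (hB.isOpen_compl.mem_nhds hx) hG
  rw [hamField_eq, this.fderiv_eq]
  simp

theorem IsGeneratedBy.fixesOff {B : Set (Phase n)} (hB : IsClosed B) (hab : a < b)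
    (hf : IsGeneratedBy a b F f) (hs : ∀ t ∈ Icc a b, IsSymp (f t))
    (hF : ∀ t ∈ Icc a b, ∀ x, x ∉ B → F t x = 0) {r t : ℝ} (hr : r ∈ Icc a b) (ht : t ∈ Icc a b)
    (h : FixesOff B (f r)) : FixesOff B (f t) := by
  intro x hx
  have h1 : ∀ s ∈ Icc a b, (f s).symm x = (f a).symm x := fun s hs' =>
    hf.symm_apply_eq hab hs (fun t ht => hamField_eq_zero hB (hF t ht) hx) hs'
  have h2 : (f r).symm x = x := by rw [Equiv.symm_apply_eq, h x hx]
  rw [← Equiv.eq_symm_apply, h1 t ht, ← h1 r hr, h2]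

/-- Information propagates backwards from the endpoint: outside the closed set `B` the preimage of a
point stays constant along each piece. -/
theorem Reach.fixesOff {B : Set (Phase n)} (hB : IsClosed B) {c : ℕ → ℝ≥0∞}
    (h : Reach B c a b φ ψ) (hψ : FixesOff B ψ) : FixesOff B φ := by
  induction h with
  | piece hab _ hf hm hB' _ =>
    exact hf.fixesOff hB hab (fun t ht => isSymp_of_mem_Ham (hm t ht)) hB'
      (right_mem_Icc.2 hab.le) (left_mem_Icc.2 hab.le) hψ
  | trans _ _ ih ih' => exact ih (ih' hψ)

end

/-! ### Products over disjoint slots -/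

section

variable {n : ℕ} {a b : ℝ} {F G : ℝ → Phase n → ℝ} {f g : ℝ → Equiv.Perm (Phase n)}
  {φ ψ χ : Equiv.Perm (Phase n)}

/-- The product of the conjugates `T ^ j * u j * T ^ (-j)`, `j < N`. -/
def slotProd (T : Equiv.Perm (Phase n)) (u : ℕ → Equiv.Perm (Phase n)) :
    ℕ → Equiv.Perm (Phase n)
  | 0 => 1
  | N + 1 => slotProd T u N * (T ^ N * u N * (T ^ N)⁻¹)

/-- The translates of `B` under the powers of `T` are pairwise disjoint. -/
def DisjointSlots (T : Equiv.Perm (Phase n)) (B : Set (Phase n)) : Prop :=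
  ∀ i j x, (T ^ i).symm x ∈ B → (T ^ j).symm x ∈ B → i = j

variable {T : Equiv.Perm (Phase n)} {B : Set (Phase n)} {u v : ℕ → Equiv.Perm (Phase n)}
  {N k : ℕ} {x : Phase n}

/-- Peels off slot `0` instead of the last slot, exhibiting the rest as a copy shifted by `T`; the
telescoping of `h` rests on this. -/
theorem slotProd_succ_eq_conj (T : Equiv.Perm (Phase n)) (u : ℕ → Equiv.Perm (Phase n)) (N : ℕ) :
    slotProd T u (N + 1) = u 0 * (T * slotProd T (fun j => u (j + 1)) N * T⁻¹) := by
  induction N with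
  | zero => simp [slotProd]
  | succ N ih =>
    rw [slotProd, ih, slotProd, pow_succ' T N]
    group

theorem slotProd_mem_Ham (hT : IsSymp T) (hu : ∀ j < N, u j ∈ Ham n) :
    slotProd T u N ∈ Ham n := by
  induction N with
  | zero => exact one_mem_Ham
  | succ N ih =>
    exact mul_mem_Ham (ih fun j hj => hu j (by omega))
      (conj_mem_Ham (hu N (by omega)) (hT.pow N))

theorem slotProd_isSymp (hT : IsSymp T) (hu : ∀ j < N, IsSymp (u j)) :
    IsSymp (slotProd T u N) := by
  induction N with
  | zero => exact IsSymp.one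
  | succ N ih =>
    exact (ih fun j hj => hu j (by omega)).mul
      (((hT.pow N).mul (hu N (by omega))).mul (hT.pow N).inv)

theorem slotProd_apply_of_notMem (hu : ∀ j < N, FixesOff B (u j))
    (hx : ∀ j < N, (T ^ j).symm x ∉ B) : slotProd T u N x = x := by
  induction N with
  | zero => rfl
  | succ N ih =>
    rw [slotProd]
    simp only [Equiv.Perm.mul_apply, Equiv.Perm.coe_inv]
    rw [hu N (by omega) _ (hx N (by omega)), Equiv.apply_symm_apply]
    exact ih (fun j hj => hu j (by omega)) fun j hj => hx j (by omega)

theorem slotProd_apply_of_mem (hT : DisjointSlots T B) (hu : ∀ j < N, FixesOff B (u j))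
    (hk : k < N) (hx : (T ^ k).symm x ∈ B) :
    slotProd T u N x = (T ^ k) (u k ((T ^ k).symm x)) := by
  induction N with
  | zero => omega
  | succ N ih =>
    rw [slotProd]
    simp only [Equiv.Perm.mul_apply, Equiv.Perm.coe_inv]
    rcases Nat.lt_succ_iff_lt_or_eq.1 hk with h | rfl
    · rw [hu N (by omega) _ fun h' => h.ne (hT _ _ _ hx h'), Equiv.apply_symm_apply]
      exact ih (fun j hj => hu j (by omega)) h
    · refine slotProd_apply_of_notMem (fun j hj => hu j (by omega)) fun j hj h' => ?_
      refine hj.ne (hT _ _ _ h' ?_)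
      rw [Equiv.symm_apply_apply]
      exact (hu k (by omega)).apply_mem hx

/-- Each point lies in at most one slot, so factors in different slots do not interact. -/
theorem slotProd_mul (hT : DisjointSlots T B) (hu : ∀ j < N, FixesOff B (u j))
    (hv : ∀ j < N, FixesOff B (v j)) :
    slotProd T (fun j => u j * v j) N = slotProd T u N * slotProd T v N := by
  ext1 x
  have huv : ∀ j < N, FixesOff B (u j * v j) := fun j hj => (hu j hj).mul (hv j hj)
  rw [Equiv.Perm.mul_apply]
  by_cases h : ∃ j < N, (T ^ j).symm x ∈ B
  · obtain ⟨j, hj, hx⟩ := h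
    rw [slotProd_apply_of_mem hT huv hj hx, slotProd_apply_of_mem hT hv hj hx,
      slotProd_apply_of_mem hT hu hj
        (by rw [Equiv.symm_apply_apply]; exact (hv j hj).apply_mem hx),
      Equiv.symm_apply_apply, Equiv.Perm.mul_apply]
  · push Not at h
    rw [slotProd_apply_of_notMem huv h, slotProd_apply_of_notMem hv h,
      slotProd_apply_of_notMem hu h]

/-- The sum of the translates of the functions `F j`, `j < N`. -/
def slotSum (T : Equiv.Perm (Phase n)) (F : ℕ → ℝ → Phase n → ℝ) (N : ℕ) (t : ℝ) (x : Phase n) :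
    ℝ :=
  ∑ j ∈ Finset.range N, F j t ((T ^ j).symm x)

section Generation

variable {F : ℕ → ℝ → Phase n → ℝ} {f : ℕ → ℝ → Equiv.Perm (Phase n)}

/-- The slot containing `x` does not depend on `t`, so either alternative can be differentiated in
time. -/
theorem slotSum_cases (hT : DisjointSlots T B)
    (hB : ∀ j < N, ∀ t ∈ Icc a b, ∀ x, x ∉ B → F j t x = 0) (x : Phase n) :
    (∀ t ∈ Icc a b, slotSum T F N t x = 0) ∨
      ∃ j < N, ∀ t ∈ Icc a b, slotSum T F N t x = F j t ((T ^ j).symm x) := by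
  by_cases h : ∃ j < N, (T ^ j).symm x ∈ B
  · obtain ⟨j, hj, hx⟩ := h
    refine Or.inr ⟨j, hj, fun t ht => Finset.sum_eq_single_of_mem j (Finset.mem_range.2 hj) ?_⟩
    exact fun i hi hij => hB i (Finset.mem_range.1 hi) t ht _ fun h => hij (hT _ _ _ h hx)
  · push Not at h
    exact Or.inl fun t ht => Finset.sum_eq_zero fun j hj =>
      hB j (Finset.mem_range.1 hj) t ht _ (h j (Finset.mem_range.1 hj))

theorem slotProd_generated (hab : a < b) (hTs : IsSymp T) (hT : DisjointSlots T B)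
    (hF : ∀ j < N, IsNormalized a b (F j)) (hf : ∀ j < N, IsGeneratedBy a b (F j) (f j))
    (hs : ∀ j < N, ∀ t ∈ Icc a b, IsSymp (f j t))
    (hB : ∀ j < N, ∀ t ∈ Icc a b, ∀ x, x ∉ B → F j t x = 0)
    (hfix : ∀ j < N, ∀ t ∈ Icc a b, FixesOff B (f j t)) :
    IsNormalized a b (slotSum T F N) ∧
      IsGeneratedBy a b (slotSum T F N) fun t => slotProd T (fun j => f j t) N := by
  induction N with
  | zero =>
    have e : slotSum T F 0 = fun _ _ => 0 := by ext t x; simp [slotSum]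
    rw [e]
    exact ⟨isNormalized_zero, isGeneratedBy_one⟩
  | succ N ih =>
    obtain ⟨ih1, ih2⟩ := ih (fun j hj => hF j (by omega)) (fun j hj => hf j (by omega))
      (fun j hj => hs j (by omega)) (fun j hj => hB j (by omega)) (fun j hj => hfix j (by omega))
    have hN := Nat.lt_succ_self N
    have e : ∀ t ∈ Icc a b, (fun x => slotSum T F N t x +
        F N t ((T ^ N).symm ((slotProd T (fun j => f j t) N).symm x))) = slotSum T F (N + 1) t := by
      intro t ht
      ext x
      -- The composition formula twists the new Hamiltonian by the inverse of the earlier product.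
      -- That product is the identity on slot `N`, so the twist has no effect.
      have hfix' : ∀ y, (T ^ N).symm y ∈ B → slotProd T (fun j => f j t) N y = y := fun y hy =>
        slotProd_apply_of_notMem (fun j hj => hfix j (by omega) t ht)
          fun j hj h => hj.ne (hT _ _ _ h hy)
      have : F N t ((T ^ N).symm ((slotProd T (fun j => f j t) N).symm x)) =
          F N t ((T ^ N).symm x) := by
        obtain ⟨y, rfl⟩ := (slotProd T (fun j => f j t) N).surjective x
        rw [Equiv.symm_apply_apply]
        by_cases h : (T ^ N).symm y ∈ B
        · rw [hfix' y h]
        · rw [hB N hN t ht _ h, hB N hN t ht]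
          intro h'
          have := (slotProd T (fun j => f j t) N).injective (hfix' _ h')
          exact h (this ▸ h')
      rw [this, slotSum, slotSum, Finset.sum_range_succ]
    have hs' : ∀ t ∈ Icc a b, IsSymp (slotProd T (fun j => f j t) N) := fun t ht =>
      slotProd_isSymp hTs fun j hj => hs j (by omega) t ht
    have hG := (hF N hN).comp_symm (hTs.pow N)
    have hg := (hf N hN).conj (hF N hN) (hTs.pow N)
    exact ⟨(ih1.add_comp_symm ih2 hG).congr e,
      (IsGeneratedBy.mul hab ih1 ih2 hs' hG hg).congr e fun _ _ => rfl⟩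

end Generation

/-- The bound `c` does not depend on `N`: at each point the summed derivative is a value of the
derivative for a single copy. The value `0` is among these, taken at a point `z` outside `B`. -/
theorem Reach.slotProd {c : ℕ → ℝ≥0∞} (hTs : IsSymp T) (hT : DisjointSlots T B)
    (hB : IsClosed B) (h : Reach B c a b φ ψ) (hψ : FixesOff B ψ) (N : ℕ) :
    Reach univ c a b (slotProd T (fun _ => φ) N) (slotProd T (fun _ => ψ) N) := by
  obtain ⟨z, hz⟩ : ∃ z, z ∉ B := by
    by_contra! h
    exact zero_ne_one (hT 0 1 0 (h _) (h _))
  induction h with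
  | @piece a b F f hab hF hf hm hB' hc =>
    have hs : ∀ t ∈ Icc a b, IsSymp (f t) := fun t ht => isSymp_of_mem_Ham (hm t ht)
    obtain ⟨h1, h2⟩ := slotProd_generated (N := N) (F := fun _ => F) (f := fun _ => f) hab hTs hT
      (fun _ _ => hF) (fun _ _ => hf) (fun _ _ => hs) (fun _ _ => hB') fun _ _ t ht =>
        hf.fixesOff hB hab hs hB' (right_mem_Icc.2 hab.le) ht hψ
    refine Reach.piece hab h1 h2 (fun s hs => slotProd_mem_Ham hTs fun _ _ => hm s hs)
      (fun _ _ _ h => absurd (mem_univ _) h) fun i s hs => ?_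
    refine (osc_le_of_forall_exists fun x => ?_).trans (hc i s hs)
    rcases slotSum_cases hT (fun (j : ℕ) (_ : j < N) => hB') x with h | ⟨j, _, h⟩
    · exact ⟨z, iteratedDerivWithin_congr
        (fun t ht => (h t ht).trans (hB' t ht z hz).symm) hs⟩
    · exact ⟨_, iteratedDerivWithin_congr h hs⟩
  | trans _ h' ih ih' => exact (ih (h'.fixesOff hB hψ)).trans (ih' hψ)

theorem slotProd_one (N : ℕ) : slotProd T (fun _ => 1) N = 1 := by
  induction N with
  | zero => rfl
  | succ N ih => rw [slotProd, ih]; group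

end

/-! ### Shears, and the commutator formula for a displaced isotopy -/

section

variable {n : ℕ} {φ ψ χ : Equiv.Perm (Phase n)}

theorem apply_sgrad_self (ℓ : Phase n →L[ℝ] ℝ) : ℓ (sgrad n ℓ) = 0 := by
  have h1 := omega_sgrad ℓ (sgrad n ℓ)
  have h2 := omega_skew (sgrad n ℓ) (sgrad n ℓ)
  linarith

/-- The shear `x ↦ x + g (ℓ x) • sgrad ℓ`. -/
def shear (ℓ : Phase n →L[ℝ] ℝ) (g : ℝ → ℝ) : Equiv.Perm (Phase n) where
  toFun x := x + g (ℓ x) • sgrad n ℓ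
  invFun x := x - g (ℓ x) • sgrad n ℓ
  left_inv x := by simp [apply_sgrad_self]
  right_inv x := by simp [apply_sgrad_self]

theorem shear_apply (ℓ : Phase n →L[ℝ] ℝ) (g : ℝ → ℝ) (x : Phase n) :
    shear ℓ g x = x + g (ℓ x) • sgrad n ℓ := rfl

theorem shear_symm_apply (ℓ : Phase n →L[ℝ] ℝ) (g : ℝ → ℝ) (x : Phase n) :
    (shear ℓ g).symm x = x - g (ℓ x) • sgrad n ℓ := rfl

theorem shear_mul (ℓ : Phase n →L[ℝ] ℝ) (g h : ℝ → ℝ) :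
    shear ℓ g * shear ℓ h = shear ℓ fun s => g s + h s := by
  ext1 x
  simp only [Equiv.Perm.mul_apply, shear_apply, map_add, map_smul, apply_sgrad_self, smul_zero,
    add_zero, add_smul]
  abel

theorem shear_pow (ℓ : Phase n →L[ℝ] ℝ) (g : ℝ → ℝ) (j : ℕ) :
    shear ℓ g ^ j = shear ℓ fun s => j * g s := by
  induction j with
  | zero => ext1 x; simp [shear_apply]
  | succ j ih => rw [pow_succ, ih, shear_mul]; congr 1; ext s; push_cast; ring

theorem isSymp_shear (ℓ : Phase n →L[ℝ] ℝ) {g : ℝ → ℝ} (hg : ContDiff ℝ ∞ g) :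
    IsSymp (shear ℓ g) where
  smooth := contDiff_id.add ((hg.comp ℓ.contDiff).smul contDiff_const)
  smooth_symm := contDiff_id.sub ((hg.comp ℓ.contDiff).smul contDiff_const)
  omega_fderiv x u v := by
    have h1 : HasFDerivAt (fun y => g (ℓ y)) (deriv g (ℓ x) • ℓ) x :=
      ((hg.differentiable (by simp) (ℓ x)).hasDerivAt).comp_hasFDerivAt x ℓ.hasFDerivAt
    have h2 : HasFDerivAt (shear ℓ g) (ContinuousLinearMap.id ℝ _ +
        (deriv g (ℓ x) • ℓ).smulRight (sgrad n ℓ)) x :=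
      (hasFDerivAt_id x).add (h1.smul_const _)
    rw [h2.fderiv]
    simp only [add_apply, ContinuousLinearMap.id_apply,
      ContinuousLinearMap.smulRight_apply, smul_apply, smul_eq_mul,
      ← omegaCLM_apply, map_add, map_smul]
    simp only [omegaCLM_apply, omega_sgrad, apply_sgrad_self, omega_skew u (sgrad n ℓ)]
    ring

section Displacement

variable {T D : Equiv.Perm (Phase n)} {B K : Set (Phase n)} {c : ℕ → ℝ≥0∞}
  {H : ℝ → Phase n → ℝ} {f : ℝ → Equiv.Perm (Phase n)}

/-- For `x ∈ K` the point `T ^ k x` is fixed by `D⁻¹`, sent by `Ψ` to `T ^ k (ψ x)`, by `D` to `T ^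
(k + 1) (ψ x)`, and by `Ψ⁻¹` to `T ^ (k + 1) x`. The last move uses slot `k + 1`, hence `N + 1`
copies of `ψ` for `k < N`. -/
theorem displaced_apply (hcomm : Commute D T) (hT : DisjointSlots T B) (hKB : K ⊆ B)
    (hψ : FixesOff B ψ) (hDK : ∀ x ∈ K, D x = x) (hDψ : ∀ x ∈ K, D (ψ x) = T (ψ x))
    {N k : ℕ} (hk : k < N) {x : Phase n} (hx : x ∈ K) :
    ((slotProd T (fun _ => ψ) (N + 1))⁻¹ * (D * slotProd T (fun _ => ψ) (N + 1) * D⁻¹))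
      ((T ^ k) x) = T ((T ^ k) x) := by
  have hc : ∀ z, D ((T ^ k) z) = (T ^ k) (D z) := fun z =>
    DFunLike.congr_fun (hcomm.pow_right k).eq z
  have hslot : ∀ j < N + 1, slotProd T (fun _ => ψ) (N + 1) ((T ^ j) x) = (T ^ j) (ψ x) := by
    intro j hj
    rw [slotProd_apply_of_mem hT (fun _ _ => hψ) hj
      (by rw [Equiv.symm_apply_apply]; exact hKB hx), Equiv.symm_apply_apply]
  have h1 : D.symm ((T ^ k) x) = (T ^ k) x := by
    rw [Equiv.symm_apply_eq, hc, hDK x hx]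
  have h2 : T ((T ^ k) x) = (T ^ (k + 1)) x := by rw [pow_succ']; rfl
  simp only [Equiv.Perm.mul_apply, Equiv.Perm.coe_inv]
  rw [h1, hslot k (by omega), hc, hDψ x hx, h2, Equiv.symm_apply_eq, hslot (k + 1) (by omega),
    pow_succ]
  rfl

/-- Short paths to the identity for products of small increments of an isotopy. -/
theorem exists_reach_increments (hTs : IsSymp T) (hT : DisjointSlots T K)
    (hH : IsNormalized 0 1 H) (hf : IsHamIsotopy H f)
    (hHK : ∀ t ∈ Icc (0 : ℝ) 1, ∀ x, x ∉ K → H t x = 0)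
    (hfix : ∀ t ∈ Icc (0 : ℝ) 1, FixesOff K (f t)) :
    ∃ C : ℕ → ℝ, ∀ N : ℕ, 0 < N → Reach univ (fun i => ENNReal.ofReal (C i / N)) 0 1
      (slotProd T (fun j => f (1 - ((j + 1 : ℕ) : ℝ) / N) * (f (1 - (j : ℝ) / N))⁻¹) N) 1 := by
  choose C hC using fun i => (hH.iteratedDerivWithin one_pos i).exists_bound
  refine ⟨fun i => 2 * C i, fun N hN => ?_⟩
  have hN' : (0 : ℝ) < N := Nat.cast_pos.2 hN
  have hN1 : (1 : ℝ) ≤ N := Nat.one_le_cast.2 hN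
  set lam : ℝ := 1 / N with hlam
  have hlam0 : 0 < lam := by positivity
  have hlam1 : lam ≤ 1 := by rw [hlam, div_le_one hN']; exact hN1
  set μ : ℕ → ℝ := fun j => 1 - ((j + 1 : ℕ) : ℝ) / N with hμ
  have hμ' : ∀ j : ℕ, 1 - (j : ℝ) / N = μ j + lam := fun j => by
    simp only [hμ, hlam]; push_cast; ring
  have hμ0 : ∀ j < N, 0 ≤ μ j := fun j hj => by
    simp only [hμ, sub_nonneg]
    rw [div_le_one hN']
    exact_mod_cast hj
  have hμ1 : ∀ j, μ j + lam ≤ 1 := fun j => by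
    rw [← hμ' j]
    have : 0 ≤ (j : ℝ) / N := by positivity
    linarith
  have he : ∀ j < N, MapsTo (fun s => μ j + lam * s) (Icc 0 1) (Icc 0 1) := fun j hj s hs =>
    ⟨by have := mul_nonneg hlam0.le hs.1; linarith [hμ0 j hj],
      by have := mul_le_mul_of_nonneg_left hs.2 hlam0.le; linarith [hμ1 j]⟩
  have hend : ∀ j < N, μ j + lam ∈ Icc (0 : ℝ) 1 := fun j hj =>
    ⟨by linarith [hμ0 j hj], hμ1 j⟩
  have hmem : ∀ j < N, ∀ t ∈ Icc (0 : ℝ) 1, f (μ j + lam * t) * (f (μ j + lam))⁻¹ ∈ Ham n :=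
    fun j hj t ht => mul_mem_Ham (hf.mem_Ham hH (he j hj ht))
      (inv_mem_Ham (hf.mem_Ham hH (hend j hj)))
  have hF0 : ∀ j < N, ∀ t ∈ Icc (0 : ℝ) 1, ∀ x, x ∉ K → lam * H (μ j + lam * t) x = 0 :=
    fun j hj t ht x hx => by rw [hHK _ (he j hj ht) x hx, mul_zero]
  -- In slot `j` the path runs from the increment at `s = 0` to the identity at `s = 1`, along the
  -- isotopy slowed down by `lam = 1 / N`.
  obtain ⟨h1, h2⟩ := slotProd_generated (T := T) (B := K) (N := N)
    (F := fun j s x => lam * H (μ j + lam * s) x)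
    (f := fun j s => f (μ j + lam * s) * (f (μ j + lam))⁻¹) (zero_lt_one' ℝ) hTs hT
    (fun j hj => hH.reparam (he j hj))
    (fun j hj => (hf.1.reparam hH (he j hj)).mul_right (hf.isSymp hH (hend j hj)).inv)
    (fun j hj t ht => isSymp_of_mem_Ham (hmem j hj t ht)) hF0
    (fun j hj t ht => (hfix _ (he j hj ht)).mul (hfix _ (hend j hj)).inv)
  have key := Reach.piece (B := univ) (c := fun i => ENNReal.ofReal (2 * C i / N)) one_pos h1 h2
    (fun s hs => slotProd_mem_Ham hTs fun j hj => hmem j hj s hs)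
    (fun _ _ _ h => absurd (mem_univ _) h) fun i s hs => ?_
  · simp only [mul_zero, add_zero, mul_one, mul_inv_cancel, slotProd_one] at key
    simp only [← hμ'] at key
    exact key
  · have hC0 : 0 ≤ C i := (abs_nonneg _).trans (hC i 0 (left_mem_Icc.2 zero_le_one) 0)
    rw [mul_div_assoc]
    refine osc_le_of_abs_le fun x => ?_
    rcases slotSum_cases hT hF0 x with h | ⟨j, hj, h⟩
    · rw [iteratedDerivWithin_congr (g := fun _ => (0 : ℝ)) (fun t ht => h t ht) hs]
      rw [iteratedDerivWithin_fun_const_zero, abs_zero]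
      positivity
    · rw [iteratedDerivWithin_congr h hs, hH.iteratedDerivWithin_reparam one_pos one_pos
        (he j hj) i hs, abs_mul, abs_of_pos (by positivity), div_eq_mul_one_div, mul_comm (C i)]
      refine mul_le_mul ?_ (hC i _ (he j hj hs) _) (abs_nonneg _) hlam0.le
      -- The factor is `lam ^ (i + 1) ≤ lam`, so every derivative is `O(1/N)`; disjoint slots keep
      -- the `N` increments from adding up.
      exact pow_le_of_le_one hlam0.le hlam1 (Nat.succ_ne_zero i)

/-- The innermost `2 ^ (i + 1) * (c i + c i)` bounds `W`; it occurs twice, for `h W h⁻¹` and for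
`W⁻¹`, and the last term bounds the increments `r`. No length of `h` enters, because bounds are
invariant under symplectic conjugation. -/
theorem exists_reach_of_displaced (hTs : IsSymp T) (hDs : IsSymp D) (hcomm : Commute D T)
    (hT : DisjointSlots T B) (hB : IsClosed B) (hK : IsClosed K) (hKB : K ⊆ B)
    (hψ : Reach B c 0 1 ψ 1) (hDK : ∀ x ∈ K, D x = x) (hDψ : ∀ x ∈ K, D (ψ x) = T (ψ x))
    (hH : IsNormalized 0 1 H) (hf : IsHamIsotopy H f)
    (hHK : ∀ t ∈ Icc (0 : ℝ) 1, ∀ x, x ∉ K → H t x = 0) :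
    ∃ C : ℕ → ℝ, ∀ N : ℕ, 0 < N → Reach univ (fun i => 2 ^ (i + 1) *
      (2 ^ (i + 1) * (2 ^ (i + 1) * (c i + c i) + 2 ^ (i + 1) * (c i + c i)) +
        ENNReal.ofReal (C i / N))) 0 1 (f 1) 1 := by
  have hTK : DisjointSlots T K := fun i j x h h' => hT i j x (hKB h) (hKB h')
  have hfix : ∀ t ∈ Icc (0 : ℝ) 1, FixesOff K (f t) := fun t ht =>
    hf.1.fixesOff hK one_pos (fun t ht => hf.isSymp hH ht) hHK (left_mem_Icc.2 zero_le_one) ht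
      (hf.2 ▸ FixesOff.one)
  obtain ⟨C, hC⟩ := exists_reach_increments hTs hTK hH hf hHK hfix
  refine ⟨C, fun N hN => ?_⟩
  have hN' : (0 : ℝ) < N := Nat.cast_pos.2 hN
  set Ψ := slotProd T (fun _ => ψ) (N + 1)
  set W := Ψ⁻¹ * (D * Ψ * D⁻¹)
  set u : ℕ → Equiv.Perm (Phase n) := fun j => f (1 - (j : ℝ) / N)
  set h := slotProd T u N
  set r := slotProd T (fun j => u (j + 1) * (u j)⁻¹) N
  have hΨ : Reach univ c 0 1 Ψ 1 := by
    simpa only [slotProd_one] using hψ.slotProd hTs hT hB FixesOff.one (N + 1)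
  have hDΨ : Reach univ c 0 1 (D * Ψ * D⁻¹) 1 := by simpa using hΨ.conj hDs
  have hW := hΨ.inv.mul hDΨ
  have hut : ∀ j ≤ N, 1 - (j : ℝ) / N ∈ Icc (0 : ℝ) 1 := fun j hj => by
    have h1 : (j : ℝ) / N ≤ 1 := (div_le_one hN').2 (Nat.cast_le.2 hj)
    have h2 : 0 ≤ (j : ℝ) / N := by positivity
    exact ⟨by linarith, by linarith⟩
  have hufix : ∀ j ≤ N, FixesOff K (u j) := fun j hj => hfix _ (hut j hj)
  have hh : IsSymp h := slotProd_isSymp hTs fun j hj => hf.isSymp hH (hut j hj.le)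
  have hhW := hW.conj hh
  rw [mul_one, mul_inv_cancel] at hhW
  have hr := (hC N hN).conj hTs
  rw [mul_one, mul_inv_cancel] at hr
  -- `h` moves only points of the first `N` translates of `K`, and there `W` agrees with `T`.
  have hWh : W * h * W⁻¹ = T * h * T⁻¹ := by
    refine FixesOff.conj_eq (B := {x | ∃ k < N, (T ^ k).symm x ∈ K}) ?_ ?_
    · intro x hx
      simp only [mem_ofPred_eq, not_exists, not_and] at hx
      exact slotProd_apply_of_notMem (fun j hj => hufix j hj.le) hx
    · rintro y ⟨k, hk, hy⟩
      have := displaced_apply hcomm hT hKB (hψ.fixesOff hB FixesOff.one) hDK hDψ hk hy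
      rwa [Equiv.apply_symm_apply] at this
  have hu0 : u 0 = f 1 := by simp [u]
  have huN : u N = 1 := by
    have : (1 : ℝ) - N / N = 0 := by rw [div_self hN'.ne', sub_self]
    simp [u, this, hf.2]
  -- Adding slot `N` does not change `h`, since `u N = f 0 = 1`. Peeling off `u 0 = f 1` leaves the
  -- shifted product of the `u (j + 1)`, each written as increment times `u j`.
  have hsplit : h = f 1 * (T * (r * h) * T⁻¹) := by
    have h1 : slotProd T u (N + 1) = h := by
      rw [slotProd, huN]
      simp [h]
    rw [← slotProd_mul hTK (fun j hj => (hufix _ hj).mul (hufix _ hj.le).inv)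
      fun j hj => hufix j hj.le]
    simp only [inv_mul_cancel_right]
    rw [← hu0, ← slotProd_succ_eq_conj, h1]
  have hfinal : f 1 = (h * W * h⁻¹) * W⁻¹ * (T * r * T⁻¹)⁻¹ := by
    have h2 : f 1 = h * (T * h * T⁻¹)⁻¹ * (T * r * T⁻¹)⁻¹ := by
      rw [eq_mul_inv_iff_mul_eq, eq_mul_inv_iff_mul_eq]
      conv_rhs => rw [hsplit]
      group
    rw [h2, ← hWh]
    group
  rw [hfinal]
  exact (hhW.mul hW.inv).mul hr.inv

end Displacement

end

/-! ### Construction of the slots, and the estimate for a given displacing map -/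

section

variable {n : ℕ} {φ ψ χ : Equiv.Perm (Phase n)}

theorem conj_pow_apply (τ S : Equiv.Perm (Phase n)) (i : ℕ) (x : Phase n) :
    (((τ⁻¹ * S * τ) ^ i).symm x) = τ.symm ((S ^ i).symm (τ x)) := by
  have h : (τ⁻¹ * S * τ) ^ i = τ⁻¹ * S ^ i * τ := by
    simpa using conj_pow (i := i) (a := τ⁻¹) (b := S)
  rw [h]
  rfl

/-- Properly separated compact sets can be pulled apart by maps as in
`exists_reach_of_displaced`. -/
theorem exists_disjointSlots {τ : Equiv.Perm (Phase n)} (hτ : IsSymp τ) {ℓ : Phase n →L[ℝ] ℝ}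
    {c₀ : ℝ} (hℓ : ℓ ≠ 0) {B K L : Set (Phase n)} (hB : IsCompact B) (hK : IsCompact K)
    (hKℓ : ∀ x ∈ K, ℓ (τ x) < c₀) (hLℓ : ∀ y ∈ L, c₀ < ℓ (τ y)) :
    ∃ T D : Equiv.Perm (Phase n), IsSymp T ∧ IsSymp D ∧ Commute D T ∧ DisjointSlots T B ∧
      (∀ x ∈ K, D x = x) ∧ ∀ y ∈ L, D y = T y := by
  -- Compactness turns the strict inequality on `K` into a gap `c₁ < c₀`, which leaves room for a
  -- smooth cutoff.
  obtain ⟨c₁, hc₁, hK₁⟩ : ∃ c₁ < c₀, ∀ x ∈ K, ℓ (τ x) ≤ c₁ := by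
    rcases K.eq_empty_or_nonempty with rfl | hne
    · exact ⟨c₀ - 1, by linarith, by simp⟩
    · obtain ⟨x, hx, hmax⟩ := hK.exists_isMaxOn hne
        (ℓ.continuous.comp hτ.smooth.continuous).continuousOn
      exact ⟨ℓ (τ x), hKℓ x hx, hmax⟩
  obtain ⟨M, hM⟩ := hB.exists_bound_of_continuousOn hτ.smooth.continuous.continuousOn
  set w := sgrad n ℓ with hw
  have hw0 : 0 < ‖w‖ := norm_pos_iff.2 (sgrad_ne_zero hℓ)
  -- `τ(B)` lies in the ball of radius `M`, so translation by a nonzero integer multiple of `R • w`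
  -- makes it disjoint from itself once `R * ‖w‖ > 2 * M`.
  obtain ⟨R, hR0, hR⟩ : ∃ R : ℝ, 0 < R ∧ 2 * M < R * ‖w‖ := by
    refine ⟨(2 * |M| + 1) / ‖w‖, by positivity, ?_⟩
    rw [div_mul_cancel₀ _ hw0.ne']
    linarith [le_abs_self M]
  set g : ℝ → ℝ := fun s => R * Real.smoothTransition ((s - c₁) / (c₀ - c₁))
  have hg : ContDiff ℝ ∞ g := contDiff_const.mul
    (Real.smoothTransition.contDiff.comp ((contDiff_id.sub contDiff_const).div_const _))
  refine ⟨τ⁻¹ * shear ℓ (fun _ => R) * τ, τ⁻¹ * shear ℓ g * τ,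
    (hτ.inv.mul (isSymp_shear ℓ contDiff_const)).mul hτ,
    (hτ.inv.mul (isSymp_shear ℓ hg)).mul hτ, ?_, ?_, ?_, ?_⟩
  · have h : shear ℓ g * shear ℓ (fun _ => R) = shear ℓ (fun _ => R) * shear ℓ g := by
      rw [shear_mul, shear_mul]
      congr 1
      ext s
      ring
    calc τ⁻¹ * shear ℓ g * τ * (τ⁻¹ * shear ℓ (fun _ => R) * τ)
        = τ⁻¹ * (shear ℓ g * shear ℓ (fun _ => R)) * τ := by group
      _ = τ⁻¹ * shear ℓ (fun _ => R) * τ * (τ⁻¹ * shear ℓ g * τ) := by rw [h]; group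
  · intro i j x hi hj
    rw [conj_pow_apply] at hi hj
    have hi' := hM _ hi
    have hj' := hM _ hj
    rw [Equiv.apply_symm_apply, shear_pow, shear_symm_apply] at hi' hj'
    by_contra hij
    have h1 : ‖((i : ℝ) - j) • (R • w)‖ ≤ M + M := by
      have e : ((i : ℝ) - j) • (R • w) =
          (τ x - ((j : ℝ) * R) • w) - (τ x - ((i : ℝ) * R) • w) := by
        module
      rw [e]
      exact (norm_sub_le _ _).trans (add_le_add hj' hi')
    rw [norm_smul, norm_smul, Real.norm_eq_abs, Real.norm_eq_abs, abs_of_pos hR0] at h1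
    have h2 : (1 : ℝ) ≤ |(i : ℝ) - j| := by
      have : (1 : ℤ) ≤ |(i : ℤ) - j| := Int.one_le_abs (by omega)
      exact_mod_cast this
    nlinarith [mul_le_mul_of_nonneg_right h2 (mul_pos hR0 hw0).le]
  · intro x hx
    have h0 : g (ℓ (τ x)) = 0 := by
      simp only [g]
      rw [Real.smoothTransition.zero_of_nonpos, mul_zero]
      exact div_nonpos_of_nonpos_of_nonneg (by linarith [hK₁ x hx]) (by linarith)
    simp [shear_apply, h0]
  · intro y hy
    have h1 : g (ℓ (τ y)) = R := by
      simp only [g]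
      rw [Real.smoothTransition.one_of_one_le, mul_one]
      rw [le_div_iff₀ (by linarith)]
      linarith [hLℓ y hy]
    simp [shear_apply, h1]

theorem le_of_forall_le_add_div {x y : ℝ≥0∞} {C : ℝ}
    (h : ∀ N : ℕ, 0 < N → x ≤ y + ENNReal.ofReal (C / N)) : x ≤ y := by
  have h1 : Filter.Tendsto (fun N : ℕ => y + ENNReal.ofReal (C / N)) Filter.atTop
      (nhds (y + ENNReal.ofReal 0)) :=
    (ENNReal.tendsto_ofReal (tendsto_const_div_atTop_nhds_zero_nat C)).const_add y
  rw [ENNReal.ofReal_zero, add_zero] at h1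
  exact ge_of_tendsto h1 (Filter.eventually_atTop.2 ⟨1, fun N hN => h N hN⟩)

/-- Taking slots of shape `B ∪ K`, with `B` supporting a path for `ψ`, makes room both for the
copies of `ψ` and for the isotopy. The slots depend on the path but not on `N`, so `N → ∞` comes
first and the infimum over paths second. -/
theorem coarseNorm_le_of_properlySeparated {K : Set (Phase n)} (hK : IsCompact K)
    {H : ℝ → Phase n → ℝ} {f : ℝ → Equiv.Perm (Phase n)} (hH : IsNormalized 0 1 H)
    (hf : IsHamIsotopy H f) (hHK : ∀ t ∈ Icc (0 : ℝ) 1, ∀ x, x ∉ K → H t x = 0)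
    (hsep : ProperlySeparated K (ψ '' K)) (k : ℕ) :
    coarseNorm k (f 1) ≤ 2 ^ (3 * k + 5) * coarseNorm k ψ := by
  obtain ⟨τ, hτ, ℓ, c₀, hℓ, h1, h2⟩ := hsep
  -- With the constant moved to the left, the right side is a bare infimum and one path can be
  -- treated at a time.
  rw [← ENNReal.div_le_iff' (by positivity) (by finiteness)]
  refine le_iInf fun γ => ?_
  rw [ENNReal.div_le_iff' (by positivity) (by finiteness)]
  obtain ⟨B, hB, hγ⟩ := γ.exists_reach
  obtain ⟨T, D, hT, hD, hcomm, hslots, hDK, hDψ⟩ :=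
    exists_disjointSlots (isSymp_of_mem_Ham hτ) hℓ (hB.union hK) hK h1 h2
  obtain ⟨C, hC⟩ := exists_reach_of_displaced hT hD hcomm hslots (hB.union hK).isClosed
    hK.isClosed subset_union_right (hγ.mono subset_union_left fun _ => le_rfl) hDK
    (fun x hx => hDψ _ (mem_image_of_mem ψ hx)) hH hf hHK
  refine le_of_forall_le_add_div
    (C := ∑ i ∈ Finset.range (k + 1), 2 ^ (i + 1) * |C i|) fun N hN => ?_
  refine ((hC N hN).coarseDist_le k).trans ?_
  rw [HamPath.length, Finset.mul_sum, Finset.sum_div,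
    ENNReal.ofReal_sum_of_nonneg fun i _ => by positivity, ← Finset.sum_add_distrib]
  refine Finset.sum_le_sum fun i hi => ?_
  have hik : i ≤ k := Nat.lt_succ_iff.1 (Finset.mem_range.1 hi)
  rw [mul_add]
  refine add_le_add ?_ ?_
  -- Three factors `2 ^ (i + 1)` and four copies of `c i`; then `i ≤ k`.
  · calc _ = (2 : ℝ≥0∞) ^ (3 * i + 5) * _ := by ring
      _ ≤ _ := by
        gcongr
        exact one_le_two
  · rw [mul_div_assoc, ENNReal.ofReal_mul (by positivity), ENNReal.ofReal_pow (by norm_num),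
      ENNReal.ofReal_ofNat]
    gcongr
    exact le_abs_self _

end

end CoarseHofer
end

/-! ### The energy-capacity type inequality -/

theorem mainTheorem8 (n k : ℕ) (U : Set (CoarseHofer.Phase n))
    (H : ℝ → CoarseHofer.Phase n → ℝ) (hH : CoarseHofer.IsNormalized 0 1 H)
    (hU : closure {z : ℝ × CoarseHofer.Phase n | z.1 ∈ Set.Icc (0 : ℝ) 1 ∧ H z.1 z.2 ≠ 0} ⊆
      Set.Icc (0 : ℝ) 1 ×ˢ U)
    (f : ℝ → Equiv.Perm (CoarseHofer.Phase n)) (hf : CoarseHofer.IsHamIsotopy H f) :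
    CoarseHofer.coarseNorm k (f 1) ≤
      2 ^ (2 * k + 4) * ((k : ENNReal) + 1) *
        (1 + 2 ^ (k + 1) + 2 ^ (2 * k + 2) + 2 ^ (3 * k + 3)) *
        CoarseHofer.properEnergy k U := by
  set Z := {z : ℝ × CoarseHofer.Phase n | z.1 ∈ Set.Icc (0 : ℝ) 1 ∧ H z.1 z.2 ≠ 0}
  obtain ⟨K₀, hK₀, hK₀0⟩ := hH.compact
  have hZ : IsCompact (closure Z) := (isCompact_Icc.prod hK₀).closure_of_subset
    fun z hz => ⟨hz.1, by_contra fun h => hz.2 (hK₀0 _ hz.1 _ h)⟩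
  -- This compact set carries every `H t` and lies in `U`, so it can be used as the bounded set `A`
  -- in the definition of the energy.
  have hK : IsCompact (Prod.snd '' closure Z) := hZ.image continuous_snd
  have hKU : Prod.snd '' closure Z ⊆ U := by
    rintro _ ⟨z, hz, rfl⟩
    exact (hU hz).2
  have hHK : ∀ t ∈ Set.Icc (0 : ℝ) 1, ∀ x, x ∉ Prod.snd '' closure Z → H t x = 0 :=
    fun t ht x hx => by_contra fun h => hx ⟨(t, x), subset_closure ⟨ht, h⟩, rfl⟩
  -- Only the summand `2 ^ (k + 1)` of the bracket is needed, because `(2 * k + 4) + (k + 1) = 3 * k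
  -- + 5`.
  have hconst : (2 : ENNReal) ^ (3 * k + 5) ≤ 2 ^ (2 * k + 4) * ((k : ENNReal) + 1) *
      (1 + 2 ^ (k + 1) + 2 ^ (2 * k + 2) + 2 ^ (3 * k + 3)) :=
    calc (2 : ENNReal) ^ (3 * k + 5) = 2 ^ (2 * k + 4) * 1 * 2 ^ (k + 1) := by ring
      _ ≤ _ := by
        gcongr
        · exact le_add_self
        · exact ((le_add_self.trans le_self_add).trans le_self_add)
  refine le_trans ?_ (mul_le_mul_left hconst _)
  rw [← ENNReal.div_le_iff' (by positivity) (by finiteness)]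
  refine le_sInf fun a ⟨_, _, ha⟩ => ?_
  obtain ⟨ψ, _, hψa, hsep⟩ := ha _ hKU hK.isBounded
  rw [ENNReal.div_le_iff' (by positivity) (by finiteness)]
  exact (CoarseHofer.coarseNorm_le_of_properlySeparated hK hH hf hHK hsep k).trans
    (mul_le_mul_right hψa _)
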